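/- For functions $u(x,y,t)$, $v(x,y,t)$ put $\{f,g\}=f_xg_y-g_xf_y$ and $\nabla^2=\partial_x^2+\partial_y^2$. Consider the system $$\text{(EU)}\qquad \partial_t(u-\nabla^2u)-\{u-\nabla^2u,v\}+\{u,\nabla^2v\}=0,\qquad \partial_t(\nabla^2v)-\{u,\nabla^2u\}+\{v,\nabla^2v\}=0,$$ (equivalently, $\partial_t(u-\nabla^2u\pm\nabla^2v)+\{v\pm u,\,u-\nabla^2u\pm\nabla^2v\}=0$), the truncated system $$\text{(T)}\qquad \partial_t(u-\nabla^2u)-\{u-\nabla^2u,v\}=0,\qquad \partial_t(\nabla^2v)-\{u,\nabla^2u\}+\{v,\nabla^2v\}=0,$$ and the constraints $$(c_1)\ \ \{u,\nabla^2v\}=0,\qquad (c_2)\ \ \{u,\nabla^2u\}=0 .$$ A (Lie point) symmetry of a system $\Delta=0$ on an open set $\Omega\subseteq\mathbb R^5$ of the space of $(x,y,t,u,v)$ is a smooth vector field $X=\xi\,\partial_x+\eta\,\partial_y+\tau\,\partial_t+\varphi\,\partial_u+\psi\,\partial_v$ on $\Omega$ whose prolongation $X^*$ satisfies $X^*(\Delta)=0$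 at all jets over $\Omega$ at which $\Delta=0$. Then, for every open $\Omega$: (i) (T) has exactly the same symmetries as (EU). (ii) The same is true if one or both of the constraints are appended: for every nonempty $C\subseteq\{c_1,c_2\}$, the system (T) with $C$ appended has exactly the same symmetries as (EU) with $C$ appended. (iii) Compared with the symmetries of (EU) itself: (T) with $c_1$ appended has exactly the symmetries of (EU); and if $\Omega$ is connected and nonempty, (T) with $c_2$ appended, or with both $c_1$ and $c_2$ appended, has as its symmetries exactly the vector fields $Y+c\,u\,\partial_u$, where $Y$ is a symmetry of (EU) and $c\in\mathbb R$ (that is, the symmetries of (EU) together with the partial symmetry $u\,\partial_u$). -/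

import Mathlib

open scoped ContDiff

/-- The space of independent variables `(x, y, t)` and dependent variables `(u, v)`. -/
abbrev PhaseSpace : Type := (Fin 3 → ℝ) × (Fin 2 → ℝ)

/-- The (infinite) jet space of two functions of three variables: a jet `j` consists of a point
`j.1 = (x, y, t)` and, for each dependent variable `a` (`0` for `u`, `1` for `v`) and each
multi-index `J`, of the value `j.2 a J` of the derivative coordinate of order `J` of that
variable. -/
abbrev JetSpace : Type := (Fin 3 → ℝ) × (Fin 2 → (Fin 3 → ℕ) → ℝ)

/-- The multi-index of the first-order derivative with respect to the `i`-th variable. -/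
def unitIndex (i : Fin 3) : Fin 3 → ℕ := Pi.single i 1

/-- The projection of a jet to its underlying point `(x, y, t, u, v)`. -/
def basePoint (j : JetSpace) : PhaseSpace := (j.1, fun a => j.2 a 0)

/-- The total derivative `D_i F = ∂F/∂x_i + ∑_{a, J} u^a_{J + e_i} ∂F/∂u^a_J` of a differential
function `F`, written as the directional derivative of `F` along the vector with components `e_i`
(in `x`) and `u^a_{J + e_i}` (in `u^a_J`); differential functions depend on finitely many
coordinates only. -/
noncomputable def totalDeriv (i : Fin 3) (F : JetSpace → ℝ) : JetSpace → ℝ := fun j =>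
  lineDeriv ℝ F j (Pi.single i 1, fun a J => j.2 a (J + unitIndex i))

/-- The iterated total derivative `D_J = D_x^{J_0} D_y^{J_1} D_t^{J_2}`. -/
noncomputable def totalDerivMulti (J : Fin 3 → ℕ) (F : JetSpace → ℝ) : JetSpace → ℝ :=
  (totalDeriv 0)^[J 0] ((totalDeriv 1)^[J 1] ((totalDeriv 2)^[J 2] F))

/-- The characteristic `Q_a = φ_a - ∑_i ξ_i u^a_i` of the vector field
`X = ∑_i ξ_i ∂/∂x_i + ∑_a φ_a ∂/∂u^a`, where `(X p).1 = ξ(p)` and `(X p).2 = φ(p)`. -/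
noncomputable def characteristic (X : PhaseSpace → PhaseSpace) (a : Fin 2) : JetSpace → ℝ :=
  fun j => (X (basePoint j)).2 a - ∑ i, (X (basePoint j)).1 i * j.2 a (unitIndex i)

/-- The prolongation `X*` of a vector field to the jet space:
`X* = ∑_i ξ_i ∂/∂x_i + ∑_{a, J} (D_J Q_a + ∑_i ξ_i u^a_{J + e_i}) ∂/∂u^a_J`. -/
noncomputable def prolongation (X : PhaseSpace → PhaseSpace) (j : JetSpace) : JetSpace :=
  ((X (basePoint j)).1, fun a J => totalDerivMulti J (characteristic X a) j
    + ∑ i, (X (basePoint j)).1 i * j.2 a (J + unitIndex i))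

/-- The Lie point symmetries, on an open set `Ω` of the space of the variables `(x, y, t, u, v)`,
of the system of differential equations `F = 0`, `F ∈ S`: the smooth vector fields `X` on `Ω` such
that `X*(F)` vanishes for all `F ∈ S` at all the jets over `Ω` at which the equations of the
system hold. -/
def lieSymmetries (Ω : Set PhaseSpace) (S : Set (JetSpace → ℝ)) :
    Set (PhaseSpace → PhaseSpace) :=
  {X | ContDiffOn ℝ ∞ X Ω ∧ ∀ j : JetSpace, basePoint j ∈ Ω → (∀ F ∈ S, F j = 0) →
    ∀ F ∈ S, lineDeriv ℝ F j (prolongation X j) = 0}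

/-- The coordinate `u`, as a differential function. -/
def uCoord : JetSpace → ℝ := fun j => j.2 0 0

/-- The coordinate `v`, as a differential function. -/
def vCoord : JetSpace → ℝ := fun j => j.2 1 0

/-- The Laplacian `∇² F = F_xx + F_yy`. -/
noncomputable def laplacian2 (F : JetSpace → ℝ) : JetSpace → ℝ :=
  totalDeriv 0 (totalDeriv 0 F) + totalDeriv 1 (totalDeriv 1 F)

/-- The bracket `{F, G} = F_x G_y - G_x F_y`. -/
noncomputable def bracket (F G : JetSpace → ℝ) : JetSpace → ℝ :=
  totalDeriv 0 F * totalDeriv 1 G - totalDeriv 0 G * totalDeriv 1 F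

/-- The left-hand side of `∂_t (u - ∇² u) - {u - ∇² u, v} + {u, ∇² v} = 0`. -/
noncomputable def magneticEq : JetSpace → ℝ :=
  totalDeriv 2 (uCoord - laplacian2 uCoord) - bracket (uCoord - laplacian2 uCoord) vCoord
    + bracket uCoord (laplacian2 vCoord)

/-- The left-hand side of `∂_t (u - ∇² u) - {u - ∇² u, v} = 0`. -/
noncomputable def truncatedMagneticEq : JetSpace → ℝ :=
  totalDeriv 2 (uCoord - laplacian2 uCoord) - bracket (uCoord - laplacian2 uCoord) vCoord

/-- The left-hand side of `∂_t (∇² v) - {u, ∇² u} + {v, ∇² v} = 0`. -/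
noncomputable def vorticityEq : JetSpace → ℝ :=
  totalDeriv 2 (laplacian2 vCoord) - bracket uCoord (laplacian2 uCoord)
    + bracket vCoord (laplacian2 vCoord)

/-- The original system. -/
def originalSystem : Set (JetSpace → ℝ) := {magneticEq, vorticityEq}

/-- The truncated system, without the term `{u, ∇² v}`. -/
def truncatedSystem : Set (JetSpace → ℝ) := {truncatedMagneticEq, vorticityEq}

/-- The left-hand side of the constraint `{u, ∇² v} = 0`. -/
noncomputable def constraintUV : JetSpace → ℝ := bracket uCoord (laplacian2 vCoord)

/-- The left-hand side of the constraint `{u, ∇² u} = 0`. -/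
noncomputable def constraintUU : JetSpace → ℝ := bracket uCoord (laplacian2 uCoord)

/-- The vector field `u ∂/∂u`. -/
def scalingField : PhaseSpace → PhaseSpace := fun p => (0, ![p.2 0, 0])

/-! All the systems lead to the same determining equations, up to one scalar condition. At the jets
where the truncated first equation, the vorticity equation, c₁ and c₂ all vanish, every system in
question is satisfied. So a symmetry of any of them annihilates there the vorticity equation and
either the full or the truncated first equation. `IsWeakSymmetry` records only this, with μ = 1 or μ
= 0 for the two forms of the first equation.

This weak condition already forces all of `IsDetermined`. Write ξ, η, τ for the horizontal
components and φ, ψ for the vertical ones. Varying third-order derivatives at jets with D_i∇²u =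
D_i∇²v = 0 makes ξ, η, τ independent of (u,v), makes τ a function of time only, and gives the
Cauchy–Riemann equations for (ξ,η). Varying u_xt, u_yt, v_xt, v_yt then makes φ, ψ affine in (u,v).
The prolongation now involves only first derivatives, ∇²u, ∇²v and their first derivatives, all of
which can be prescribed freely, and ten such jets yield the rest: ξ_x = 0, φ depends only on u, ψ_u
= 0, ψ_v = -τ_t, ψ_x = η_t, ψ_y = -ξ_t and so on.

Conversely, for such a field X* multiplies each of the functions by a factor, with a single
exception: X*(V) = -2τ_t V - 2(φ_u + τ_t){u,∇²u}, where V is the left side of the vorticity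
equation. The term {u,∇²v} carries the same factor φ_u - τ_t as the truncated first equation, so
dropping it changes nothing. If c₂ belongs to the system, the exceptional term vanishes and every
determined field is a symmetry (`lieSymmetries_eq_determinedFields`). If not, a jet with {u,∇²u} = 1
solving everything else forces φ_u + τ_t = 0 (`lieSymmetries_eq_inverseScalingFields`). On a
connected set φ_u + τ_t is a constant c, and subtracting c u∂_u removes it (`determinedFields_eq`).
-/

/-- The derivative of a function on the phase space along a fixed vector. -/
noncomputable def dirDeriv (v : PhaseSpace) (f : PhaseSpace → ℝ) : PhaseSpace → ℝ :=
  fun p => fderiv ℝ f p v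

/-- The vertical vector with the given `(u, v)` components. -/
def vert (w : Fin 2 → ℝ) : PhaseSpace := (0, w)

/-- The coordinate vector of the `i`-th independent variable. -/
def hor (i : Fin 3) : PhaseSpace := (Pi.single i 1, 0)

/-- The value at a jet of the total derivative vector field, projected to the phase space. -/
def totalVec (i : Fin 3) (j : JetSpace) : PhaseSpace :=
  hor i + vert fun a => j.2 a (unitIndex i)

/-! ### Directional derivatives of smooth functions on the phase space. -/

section DirDeriv

variable {Ω : Set PhaseSpace} {f g : PhaseSpace → ℝ} {p : PhaseSpace}

theorem ContDiffOn.dirDeriv (hΩ : IsOpen Ω) (hf : ContDiffOn ℝ ∞ f Ω) (v : PhaseSpace) :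
    ContDiffOn ℝ ∞ (dirDeriv v f) Ω :=
  (hf.fderiv_of_isOpen hΩ (by simp)).clm_apply contDiffOn_const

theorem smoothOn_differentiableAt (hΩ : IsOpen Ω) (hf : ContDiffOn ℝ ∞ f Ω) (hp : p ∈ Ω) :
    DifferentiableAt ℝ f p :=
  (hf.contDiffAt (hΩ.mem_nhds hp)).differentiableAt (by simp)

theorem dirDeriv_congr (hΩ : IsOpen Ω) (h : Set.EqOn f g Ω) (v : PhaseSpace) :
    Set.EqOn (dirDeriv v f) (dirDeriv v g) Ω := fun p hp => by
  have : f =ᶠ[nhds p] g := Filter.eventuallyEq_of_mem (hΩ.mem_nhds hp) h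
  simp only [dirDeriv, this.fderiv_eq]

theorem dirDeriv_eq_zero_of_eqOn (hΩ : IsOpen Ω) {c : ℝ} (h : ∀ q ∈ Ω, f q = c) (v : PhaseSpace)
    (hp : p ∈ Ω) : dirDeriv v f p = 0 := by
  rw [dirDeriv_congr hΩ (g := fun _ => c) h v hp]
  simp [dirDeriv]

@[simp] theorem dirDeriv_add_vec (v w : PhaseSpace) :
    dirDeriv (v + w) f p = dirDeriv v f p + dirDeriv w f p := by
  simp [dirDeriv]

@[simp] theorem dirDeriv_zero_vec : dirDeriv 0 f p = 0 := by
  simp [dirDeriv]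

@[simp] theorem vert_zero : vert 0 = 0 := rfl

theorem dirDeriv_vert (w : Fin 2 → ℝ) :
    dirDeriv (vert w) f p = w 0 * dirDeriv (vert ![1, 0]) f p
      + w 1 * dirDeriv (vert ![0, 1]) f p := by
  have : vert w = w 0 • vert ![1, 0] + w 1 • vert ![0, 1] := by
    refine Prod.ext (by simp [vert]) (funext fun a => ?_)
    fin_cases a <;> simp [vert]
  simp only [dirDeriv]
  rw [this]
  simp

theorem dirDeriv_add (hΩ : IsOpen Ω) (hf : ContDiffOn ℝ ∞ f Ω) (hg : ContDiffOn ℝ ∞ g Ω)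
    (hp : p ∈ Ω) (v : PhaseSpace) :
    dirDeriv v (fun q => f q + g q) p = dirDeriv v f p + dirDeriv v g p := by
  simp only [dirDeriv]
  rw [fderiv_fun_add (smoothOn_differentiableAt hΩ hf hp) (smoothOn_differentiableAt hΩ hg hp)]
  rfl

theorem dirDeriv_const_mul (hΩ : IsOpen Ω) (hf : ContDiffOn ℝ ∞ f Ω)
    (hp : p ∈ Ω) (c : ℝ) (v : PhaseSpace) :
    dirDeriv v (fun q => c * f q) p = c * dirDeriv v f p := by
  simp only [dirDeriv]
  rw [fderiv_const_mul (smoothOn_differentiableAt hΩ hf hp)]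
  rfl

theorem smoothOn_differentiableAt_fderiv (hΩ : IsOpen Ω) (hf : ContDiffOn ℝ ∞ f Ω) (hp : p ∈ Ω) :
    DifferentiableAt ℝ (fderiv ℝ f) p :=
  ((hf.fderiv_of_isOpen hΩ (m := ∞) (by simp)).contDiffAt
    (hΩ.mem_nhds hp)).differentiableAt (by simp)

theorem smoothOn_differentiableAt_fderiv_fderiv (hΩ : IsOpen Ω) (hf : ContDiffOn ℝ ∞ f Ω)
    (hp : p ∈ Ω) : DifferentiableAt ℝ (fderiv ℝ (fderiv ℝ f)) p :=
  (((hf.fderiv_of_isOpen hΩ (m := ∞) (by simp)).fderiv_of_isOpen hΩ (m := ∞)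
    (by simp)).contDiffAt (hΩ.mem_nhds hp)).differentiableAt (by simp)

theorem fderiv_fderiv_apply (hΩ : IsOpen Ω) (hf : ContDiffOn ℝ ∞ f Ω) (hp : p ∈ Ω)
    (v w : PhaseSpace) : fderiv ℝ (fderiv ℝ f) p v w = dirDeriv v (dirDeriv w f) p := by
  have h := smoothOn_differentiableAt_fderiv hΩ hf hp
  change _ = fderiv ℝ (fun q => fderiv ℝ f q w) p v
  rw [fderiv_clm_apply h (by fun_prop)]
  simp

theorem two_le_smooth : (2 : WithTop ℕ∞) ≤ ∞ := by
  have h : ((2 : ℕ∞) : WithTop ℕ∞) ≤ ((⊤ : ℕ∞) : WithTop ℕ∞) := WithTop.coe_le_coe.2 le_top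
  exact h

theorem dirDeriv_comm (hΩ : IsOpen Ω) (hf : ContDiffOn ℝ ∞ f Ω) (hp : p ∈ Ω)
    (v w : PhaseSpace) : dirDeriv v (dirDeriv w f) p = dirDeriv w (dirDeriv v f) p := by
  rw [← fderiv_fderiv_apply hΩ hf hp, ← fderiv_fderiv_apply hΩ hf hp]
  exact ((hf.contDiffAt (hΩ.mem_nhds hp)).isSymmSndFDerivAt
    (by simpa [minSmoothness_of_isRCLikeNormedField] using two_le_smooth)) v w

theorem fderiv_fderiv_fderiv_apply (hΩ : IsOpen Ω) (hf : ContDiffOn ℝ ∞ f Ω) (hp : p ∈ Ω)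
    (u v w : PhaseSpace) : fderiv ℝ (fderiv ℝ (fderiv ℝ f)) p u v w
      = dirDeriv u (dirDeriv v (dirDeriv w f)) p := by
  have h := smoothOn_differentiableAt_fderiv_fderiv hΩ hf hp
  rw [dirDeriv_congr hΩ (f := dirDeriv v (dirDeriv w f))
    (g := fun q => fderiv ℝ (fderiv ℝ f) q v w)
    (fun q hq => (fderiv_fderiv_apply hΩ hf hq v w).symm) u hp]
  simp only [dirDeriv]
  rw [fderiv_clm_apply (h.clm_apply (by fun_prop)) (by fun_prop),
    fderiv_clm_apply h (by fun_prop)]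
  simp

/-- Additivity in the inner direction is not formal for iterated `dirDeriv`; it comes from the
bilinearity of the second Fréchet derivative. -/
theorem dirDeriv_dirDeriv_add_vec (hΩ : IsOpen Ω) (hf : ContDiffOn ℝ ∞ f Ω) (hp : p ∈ Ω)
    (v w w' : PhaseSpace) : dirDeriv v (dirDeriv (w + w') f) p
      = dirDeriv v (dirDeriv w f) p + dirDeriv v (dirDeriv w' f) p := by
  simp [← fderiv_fderiv_apply hΩ hf hp]

theorem dirDeriv_dirDeriv_vert (hΩ : IsOpen Ω) (hf : ContDiffOn ℝ ∞ f Ω) (hp : p ∈ Ω)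
    (v : PhaseSpace) (w : Fin 2 → ℝ) : dirDeriv v (dirDeriv (vert w) f) p
      = w 0 * dirDeriv v (dirDeriv (vert ![1, 0]) f) p
        + w 1 * dirDeriv v (dirDeriv (vert ![0, 1]) f) p := by
  rw [dirDeriv_comm hΩ hf hp, dirDeriv_vert, dirDeriv_comm hΩ hf hp v,
    dirDeriv_comm hΩ hf hp v]

end DirDeriv

/-! ### Total derivatives of functions pulled back from the phase space. -/

section TotalDeriv

variable {Ω : Set PhaseSpace} {f : PhaseSpace → ℝ} {F G : JetSpace → ℝ} {j : JetSpace}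

/-- Differential functions that are differentiable along all lines through jets over `Ω`. -/
def LineDiffOver (Ω : Set PhaseSpace) (F : JetSpace → ℝ) : Prop :=
  ∀ j, basePoint j ∈ Ω → ∀ v, LineDifferentiableAt ℝ F j v

theorem basePoint_add_smul (j v : JetSpace) (t : ℝ) :
    basePoint (j + t • v) = basePoint j + t • basePoint v := rfl

theorem basePoint_totalDeriv_direction (i : Fin 3) (j : JetSpace) :
    basePoint (Pi.single i 1, fun a J => j.2 a (J + unitIndex i)) = totalVec i j := by
  simp [basePoint, totalVec, hor, vert]

theorem eventually_over (hΩ : IsOpen Ω) (hj : basePoint j ∈ Ω) (v : JetSpace) :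
    ∀ᶠ t : ℝ in nhds 0, basePoint (j + t • v) ∈ Ω := by
  have hc : Continuous fun t : ℝ => basePoint j + t • basePoint v := by fun_prop
  exact hc.continuousAt.eventually_mem (hΩ.mem_nhds (by simpa using hj))

theorem lineDeriv_congr_over (hΩ : IsOpen Ω) (h : ∀ j, basePoint j ∈ Ω → F j = G j)
    (hj : basePoint j ∈ Ω) (v : JetSpace) : lineDeriv ℝ F j v = lineDeriv ℝ G j v := by
  apply Filter.EventuallyEq.deriv_eq
  filter_upwards [eventually_over hΩ hj v] with t ht using h _ ht

theorem totalDeriv_congr_over (hΩ : IsOpen Ω) (h : ∀ j, basePoint j ∈ Ω → F j = G j) (i : Fin 3)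
    (hj : basePoint j ∈ Ω) : totalDeriv i F j = totalDeriv i G j :=
  lineDeriv_congr_over hΩ h hj _

theorem LineDiffOver.congr (hΩ : IsOpen Ω) (hF : LineDiffOver Ω F)
    (h : ∀ j, basePoint j ∈ Ω → G j = F j) : LineDiffOver Ω G := fun j hj v => by
  refine DifferentiableAt.congr_of_eventuallyEq (hF j hj v) ?_
  filter_upwards [eventually_over hΩ hj v] with t ht using h _ ht

theorem LineDiffOver.mul (hF : LineDiffOver Ω F) (hG : LineDiffOver Ω G) :
    LineDiffOver Ω fun j => F j * G j := fun j hj v => (hF j hj v).fun_mul (hG j hj v)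

theorem LineDiffOver.add (hF : LineDiffOver Ω F) (hG : LineDiffOver Ω G) :
    LineDiffOver Ω fun j => F j + G j := fun j hj v => (hF j hj v).fun_add (hG j hj v)

theorem LineDiffOver.sub (hF : LineDiffOver Ω F) (hG : LineDiffOver Ω G) :
    LineDiffOver Ω fun j => F j - G j := fun j hj v => (hF j hj v).fun_sub (hG j hj v)

theorem hasDerivAt_of_hasLineDerivAt {E E' : Type*} [AddCommGroup E] [Module ℝ E]
    [NormedAddCommGroup E'] [NormedSpace ℝ E'] {h : E → E'} {h' : E'} {x v : E}
    (H : HasLineDerivAt ℝ h h' x v) : HasDerivAt (fun t : ℝ => h (x + t • v)) h' 0 := H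

theorem hasLineDerivAt_coord (a : Fin 2) (J : Fin 3 → ℕ) (j v : JetSpace) :
    HasLineDerivAt ℝ (fun j : JetSpace => j.2 a J) (v.2 a J) j v := by
  have : HasDerivAt (fun t : ℝ => j.2 a J + t * v.2 a J) (v.2 a J) 0 := by
    simpa using ((hasDerivAt_id (0 : ℝ)).mul_const (v.2 a J)).const_add (j.2 a J)
  exact this

theorem lineDiffOver_coord (a : Fin 2) (J : Fin 3 → ℕ) :
    LineDiffOver Ω fun j => j.2 a J :=
  fun j _ v => (hasLineDerivAt_coord a J j v).lineDifferentiableAt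

theorem totalDeriv_coord (i : Fin 3) (a : Fin 2) (J : Fin 3 → ℕ) :
    totalDeriv i (fun j => j.2 a J) = fun j => j.2 a (J + unitIndex i) :=
  funext fun j => (hasLineDerivAt_coord a J j _).lineDeriv

theorem totalDeriv_mul (hF : LineDiffOver Ω F) (hG : LineDiffOver Ω G) (hj : basePoint j ∈ Ω)
    (i : Fin 3) : totalDeriv i (fun j => F j * G j) j
      = totalDeriv i F j * G j + F j * totalDeriv i G j := by
  have := (hasDerivAt_of_hasLineDerivAt 
    (hF j hj (Pi.single i 1, fun a J => j.2 a (J + unitIndex i))).hasLineDerivAt).mul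
    (hasDerivAt_of_hasLineDerivAt
      (hG j hj (Pi.single i 1, fun a J => j.2 a (J + unitIndex i))).hasLineDerivAt)
  refine this.deriv.trans ?_
  simp [totalDeriv]

theorem totalDeriv_add (hF : LineDiffOver Ω F) (hG : LineDiffOver Ω G) (hj : basePoint j ∈ Ω)
    (i : Fin 3) : totalDeriv i (fun j => F j + G j) j
      = totalDeriv i F j + totalDeriv i G j :=
  deriv_fun_add (hF j hj _) (hG j hj _)

theorem totalDeriv_sub (hF : LineDiffOver Ω F) (hG : LineDiffOver Ω G) (hj : basePoint j ∈ Ω)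
    (i : Fin 3) : totalDeriv i (fun j => F j - G j) j
      = totalDeriv i F j - totalDeriv i G j :=
  deriv_fun_sub (hF j hj _) (hG j hj _)

/-- The projection is linear, so a line of jets lies over a line in the phase space, and only the
Fréchet derivative of `f` on that finite-dimensional space is needed. -/
theorem hasLineDerivAt_comp_basePoint (hΩ : IsOpen Ω) (hf : ContDiffOn ℝ ∞ f Ω)
    (hj : basePoint j ∈ Ω) (v : JetSpace) :
    HasLineDerivAt ℝ (fun j => f (basePoint j)) (dirDeriv (basePoint v) f (basePoint j)) j v :=
  (smoothOn_differentiableAt hΩ hf hj).hasFDerivAt.hasLineDerivAt (basePoint v)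

theorem lineDiffOver_comp_basePoint (hΩ : IsOpen Ω) (hf : ContDiffOn ℝ ∞ f Ω) :
    LineDiffOver Ω fun j => f (basePoint j) :=
  fun _ hj v => (hasLineDerivAt_comp_basePoint hΩ hf hj v).lineDifferentiableAt

theorem totalDeriv_comp_basePoint (hΩ : IsOpen Ω) (hf : ContDiffOn ℝ ∞ f Ω)
    (hj : basePoint j ∈ Ω) (i : Fin 3) :
    totalDeriv i (fun j => f (basePoint j)) j = dirDeriv (totalVec i j) f (basePoint j) := by
  rw [totalDeriv, (hasLineDerivAt_comp_basePoint hΩ hf hj _).lineDeriv,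
    basePoint_totalDeriv_direction]

theorem totalVec_add_smul (i : Fin 3) (j v : JetSpace) (t : ℝ) :
    totalVec i (j + t • v) = totalVec i j + t • vert fun a => v.2 a (unitIndex i) := by
  refine Prod.ext (by simp [totalVec, vert, hor]) ?_
  simp [totalVec, vert, hor]
  rfl

theorem vert_add_smul (J : Fin 3 → ℕ) (j v : JetSpace) (t : ℝ) :
    (vert fun a => (j + t • v).2 a J) = (vert fun a => j.2 a J) + t • vert fun a => v.2 a J := by
  refine Prod.ext (by simp [vert]) ?_
  simp [vert]
  rfl

theorem hasDerivAt_line {E : Type*} [NormedAddCommGroup E] [NormedSpace ℝ E] (a b : E) :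
    HasDerivAt (fun t : ℝ => a + t • b) b 0 := by
  simpa using ((hasDerivAt_id (0 : ℝ)).smul_const b).const_add a

theorem hasDerivAt_clm_line {E F : Type*} [NormedAddCommGroup E] [NormedSpace ℝ E]
    [NormedAddCommGroup F] [NormedSpace ℝ F]
    {L : E → E →L[ℝ] F} {L' : E →L[ℝ] E →L[ℝ] F} {p : E} (h : HasFDerivAt L L' p)
    (v a a' : E) :
    HasDerivAt (fun t : ℝ => L (p + t • v) (a + t • a')) (L' v a + L p a') 0 := by
  have h1 := (hasDerivAt_of_hasLineDerivAt (h.hasLineDerivAt v)).clm_apply (hasDerivAt_line a a')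
  exact h1.congr_deriv (by simp)

theorem hasDerivAt_clm_clm_line {E : Type*} [NormedAddCommGroup E] [NormedSpace ℝ E]
    {L : E → E →L[ℝ] E →L[ℝ] ℝ} {L' : E →L[ℝ] E →L[ℝ] E →L[ℝ] ℝ} {p : E}
    (h : HasFDerivAt L L' p) (v a a' b b' : E) :
    HasDerivAt (fun t : ℝ => L (p + t • v) (a + t • a') (b + t • b'))
      (L' v a b + L p a' b + L p a b') 0 := by
  have h1 := (hasDerivAt_clm_line (F := E →L[ℝ] ℝ) h v a a').clm_apply (hasDerivAt_line b b')
  refine h1.congr_deriv ?_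
  simp

/-- Along a line of jets both the base point and the vector `totalVec i j` move affinely; this is
the product rule for that situation, and it yields the higher total derivatives. -/
theorem hasDerivAt_dirDeriv_line (hΩ : IsOpen Ω) (hf : ContDiffOn ℝ ∞ f Ω) {p : PhaseSpace}
    (hp : p ∈ Ω) (v a a' : PhaseSpace) :
    HasDerivAt (fun t : ℝ => dirDeriv (a + t • a') f (p + t • v))
      (dirDeriv v (dirDeriv a f) p + dirDeriv a' f p) 0 := by
  rw [← fderiv_fderiv_apply hΩ hf hp]
  exact hasDerivAt_clm_line (smoothOn_differentiableAt_fderiv hΩ hf hp).hasFDerivAt v a a'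

theorem hasDerivAt_dirDeriv_dirDeriv_line (hΩ : IsOpen Ω) (hf : ContDiffOn ℝ ∞ f Ω)
    {p : PhaseSpace} (hp : p ∈ Ω) (v a a' b b' : PhaseSpace) :
    HasDerivAt (fun t : ℝ => fderiv ℝ (fderiv ℝ f) (p + t • v) (a + t • a') (b + t • b'))
      (dirDeriv v (dirDeriv a (dirDeriv b f)) p + dirDeriv a' (dirDeriv b f) p
        + dirDeriv a (dirDeriv b' f) p) 0 := by
  rw [← fderiv_fderiv_fderiv_apply hΩ hf hp, ← fderiv_fderiv_apply hΩ hf hp,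
    ← fderiv_fderiv_apply hΩ hf hp]
  exact hasDerivAt_clm_clm_line (smoothOn_differentiableAt_fderiv_fderiv hΩ hf hp).hasFDerivAt
    v a a' b b'

theorem hasLineDerivAt_totalDeriv_comp (hΩ : IsOpen Ω) (hf : ContDiffOn ℝ ∞ f Ω)
    (hj : basePoint j ∈ Ω) (i : Fin 3) (v : JetSpace) :
    HasLineDerivAt ℝ (fun j => dirDeriv (totalVec i j) f (basePoint j))
      (dirDeriv (basePoint v) (dirDeriv (totalVec i j) f) (basePoint j)
        + dirDeriv (vert fun a => v.2 a (unitIndex i)) f (basePoint j)) j v := by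
  simp only [HasLineDerivAt, totalVec_add_smul, basePoint_add_smul]
  exact hasDerivAt_dirDeriv_line hΩ hf hj _ _ _

theorem lineDiffOver_totalDeriv_comp (hΩ : IsOpen Ω) (hf : ContDiffOn ℝ ∞ f Ω) (i : Fin 3) :
    LineDiffOver Ω (totalDeriv i fun j => f (basePoint j)) :=
  LineDiffOver.congr hΩ
    (fun _ hj v => (hasLineDerivAt_totalDeriv_comp hΩ hf hj i v).lineDifferentiableAt)
    fun _ hj => totalDeriv_comp_basePoint hΩ hf hj i

/-- On the right the vectors are frozen at `j`, so the first term is a value of the second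
derivative of `f`. The variation of `totalVec i j` itself produces the second term. -/
theorem totalDeriv_totalDeriv_comp (hΩ : IsOpen Ω) (hf : ContDiffOn ℝ ∞ f Ω)
    (hj : basePoint j ∈ Ω) (k i : Fin 3) :
    totalDeriv k (totalDeriv i fun j => f (basePoint j)) j
      = dirDeriv (totalVec k j) (dirDeriv (totalVec i j) f) (basePoint j)
        + dirDeriv (vert fun a => j.2 a (unitIndex i + unitIndex k)) f (basePoint j) := by
  rw [totalDeriv_congr_over hΩ (fun _ hj => totalDeriv_comp_basePoint hΩ hf hj i) k hj,
    totalDeriv, (hasLineDerivAt_totalDeriv_comp hΩ hf hj i _).lineDeriv,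
    basePoint_totalDeriv_direction]

theorem hasLineDerivAt_totalDeriv_totalDeriv_comp (hΩ : IsOpen Ω) (hf : ContDiffOn ℝ ∞ f Ω)
    (hj : basePoint j ∈ Ω) (k i : Fin 3) (v : JetSpace) :
    HasLineDerivAt ℝ (totalDeriv k (totalDeriv i fun j => f (basePoint j)))
      (dirDeriv (basePoint v) (dirDeriv (totalVec k j) (dirDeriv (totalVec i j) f)) (basePoint j)
        + dirDeriv (vert fun a => v.2 a (unitIndex k)) (dirDeriv (totalVec i j) f) (basePoint j)
        + dirDeriv (totalVec k j) (dirDeriv (vert fun a => v.2 a (unitIndex i)) f) (basePoint j)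
        + dirDeriv (basePoint v)
            (dirDeriv (vert fun a => j.2 a (unitIndex i + unitIndex k)) f) (basePoint j)
        + dirDeriv (vert fun a => v.2 a (unitIndex i + unitIndex k)) f (basePoint j)) j v := by
  have h1 := (hasDerivAt_dirDeriv_dirDeriv_line hΩ hf hj (basePoint v) (totalVec k j)
    (vert fun a => v.2 a (unitIndex k)) (totalVec i j) (vert fun a => v.2 a (unitIndex i))).add
    (hasDerivAt_dirDeriv_line hΩ hf hj (basePoint v)
      (vert fun a => j.2 a (unitIndex i + unitIndex k))
      (vert fun a => v.2 a (unitIndex i + unitIndex k)))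
  rw [← add_assoc] at h1
  refine h1.congr_of_eventuallyEq ?_
  filter_upwards [eventually_over hΩ hj v] with t ht
  rw [totalDeriv_totalDeriv_comp hΩ hf ht, ← fderiv_fderiv_apply hΩ hf ht, vert_add_smul,
    totalVec_add_smul, totalVec_add_smul]
  rfl

theorem lineDiffOver_totalDeriv_totalDeriv_comp (hΩ : IsOpen Ω) (hf : ContDiffOn ℝ ∞ f Ω)
    (k i : Fin 3) : LineDiffOver Ω (totalDeriv k (totalDeriv i fun j => f (basePoint j))) :=
  fun _ hj v => (hasLineDerivAt_totalDeriv_totalDeriv_comp hΩ hf hj k i v).lineDifferentiableAt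

theorem totalDeriv_totalDeriv_totalDeriv_comp (hΩ : IsOpen Ω) (hf : ContDiffOn ℝ ∞ f Ω)
    (hj : basePoint j ∈ Ω) (l k i : Fin 3) :
    totalDeriv l (totalDeriv k (totalDeriv i fun j => f (basePoint j))) j
      = dirDeriv (totalVec l j) (dirDeriv (totalVec k j) (dirDeriv (totalVec i j) f)) (basePoint j)
        + dirDeriv (vert fun a => j.2 a (unitIndex k + unitIndex l)) (dirDeriv (totalVec i j) f)
            (basePoint j)
        + dirDeriv (totalVec k j) (dirDeriv (vert fun a => j.2 a (unitIndex i + unitIndex l)) f)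
            (basePoint j)
        + dirDeriv (totalVec l j)
            (dirDeriv (vert fun a => j.2 a (unitIndex i + unitIndex k)) f) (basePoint j)
        + dirDeriv (vert fun a => j.2 a (unitIndex i + unitIndex k + unitIndex l)) f
            (basePoint j) := by
  rw [totalDeriv, (hasLineDerivAt_totalDeriv_totalDeriv_comp hΩ hf hj k i _).lineDeriv,
    basePoint_totalDeriv_direction]

end TotalDeriv

/-! ### Leibniz rules and commutation for total derivatives up to order three. -/

section ThirdOrder

variable {Ω : Set PhaseSpace} {f : PhaseSpace → ℝ} {F G : JetSpace → ℝ} {j : JetSpace}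

/-- Differential functions that are differentiable along all lines through jets over `Ω`, together
with their total derivatives of first and second order. -/
structure LineDiffOver2 (Ω : Set PhaseSpace) (F : JetSpace → ℝ) : Prop where
  zero : LineDiffOver Ω F
  one : ∀ i, LineDiffOver Ω (totalDeriv i F)
  two : ∀ k i, LineDiffOver Ω (totalDeriv k (totalDeriv i F))

theorem lineDiffOver2_comp_basePoint (hΩ : IsOpen Ω) (hf : ContDiffOn ℝ ∞ f Ω) :
    LineDiffOver2 Ω fun j => f (basePoint j) :=
  ⟨lineDiffOver_comp_basePoint hΩ hf, lineDiffOver_totalDeriv_comp hΩ hf,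
    lineDiffOver_totalDeriv_totalDeriv_comp hΩ hf⟩

theorem totalDeriv_totalDeriv_sub (hΩ : IsOpen Ω) (hF : LineDiffOver2 Ω F)
    (hG : LineDiffOver2 Ω G) (hj : basePoint j ∈ Ω) (k i : Fin 3) :
    totalDeriv k (totalDeriv i fun j => F j - G j) j
      = totalDeriv k (totalDeriv i F) j - totalDeriv k (totalDeriv i G) j := by
  rw [totalDeriv_congr_over hΩ (fun j hj => totalDeriv_sub hF.zero hG.zero hj i) k hj,
    totalDeriv_sub (hF.one i) (hG.one i) hj]

theorem totalDeriv_totalDeriv_totalDeriv_sub (hΩ : IsOpen Ω) (hF : LineDiffOver2 Ω F)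
    (hG : LineDiffOver2 Ω G) (hj : basePoint j ∈ Ω) (l k i : Fin 3) :
    totalDeriv l (totalDeriv k (totalDeriv i fun j => F j - G j)) j
      = totalDeriv l (totalDeriv k (totalDeriv i F)) j
        - totalDeriv l (totalDeriv k (totalDeriv i G)) j := by
  rw [totalDeriv_congr_over hΩ (fun j hj => totalDeriv_totalDeriv_sub hΩ hF hG hj k i) l hj,
    totalDeriv_sub (hF.two k i) (hG.two k i) hj]

theorem LineDiffOver2.sub (hΩ : IsOpen Ω) (hF : LineDiffOver2 Ω F) (hG : LineDiffOver2 Ω G) :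
    LineDiffOver2 Ω fun j => F j - G j :=
  ⟨hF.zero.sub hG.zero,
    fun i => ((hF.one i).sub (hG.one i)).congr hΩ fun _ hj => totalDeriv_sub hF.zero hG.zero hj i,
    fun k i => ((hF.two k i).sub (hG.two k i)).congr hΩ
      fun _ hj => totalDeriv_totalDeriv_sub hΩ hF hG hj k i⟩

theorem totalDeriv_mul_coord (hF : LineDiffOver Ω F) (hj : basePoint j ∈ Ω)
    (i : Fin 3) (a : Fin 2) (J : Fin 3 → ℕ) :
    totalDeriv i (fun j => F j * j.2 a J) j
      = totalDeriv i F j * j.2 a J + F j * j.2 a (J + unitIndex i) := by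
  rw [totalDeriv_mul hF (lineDiffOver_coord a J) hj, totalDeriv_coord]

theorem totalDeriv_totalDeriv_mul_coord (hΩ : IsOpen Ω) (hF : LineDiffOver2 Ω F)
    (hj : basePoint j ∈ Ω) (k i : Fin 3) (a : Fin 2) (J : Fin 3 → ℕ) :
    totalDeriv k (totalDeriv i fun j => F j * j.2 a J) j
      = totalDeriv k (totalDeriv i F) j * j.2 a J
        + totalDeriv i F j * j.2 a (J + unitIndex k)
        + (totalDeriv k F j * j.2 a (J + unitIndex i)
        + F j * j.2 a (J + unitIndex i + unitIndex k)) := by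
  rw [totalDeriv_congr_over hΩ (fun j hj => totalDeriv_mul_coord hF.zero hj i a J) k hj,
    totalDeriv_add ((hF.one i).mul (lineDiffOver_coord a J))
      (hF.zero.mul (lineDiffOver_coord a _)) hj,
    totalDeriv_mul_coord (hF.one i) hj, totalDeriv_mul_coord hF.zero hj]

theorem totalDeriv_totalDeriv_totalDeriv_mul_coord (hΩ : IsOpen Ω) (hF : LineDiffOver2 Ω F)
    (hj : basePoint j ∈ Ω) (l k i : Fin 3) (a : Fin 2) (J : Fin 3 → ℕ) :
    totalDeriv l (totalDeriv k (totalDeriv i fun j => F j * j.2 a J)) j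
      = totalDeriv l (totalDeriv k (totalDeriv i F)) j * j.2 a J
        + totalDeriv k (totalDeriv i F) j * j.2 a (J + unitIndex l)
        + totalDeriv l (totalDeriv i F) j * j.2 a (J + unitIndex k)
        + totalDeriv l (totalDeriv k F) j * j.2 a (J + unitIndex i)
        + totalDeriv i F j * j.2 a (J + unitIndex k + unitIndex l)
        + totalDeriv k F j * j.2 a (J + unitIndex i + unitIndex l)
        + totalDeriv l F j * j.2 a (J + unitIndex i + unitIndex k)
        + F j * j.2 a (J + unitIndex i + unitIndex k + unitIndex l) := by
  have c := fun K => lineDiffOver_coord (Ω := Ω) a K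
  rw [totalDeriv_congr_over hΩ
      (fun j hj => totalDeriv_totalDeriv_mul_coord hΩ hF hj k i a J) l hj,
    totalDeriv_add (((hF.two k i).mul (c _)).add ((hF.one i).mul (c _)))
      (((hF.one k).mul (c _)).add (hF.zero.mul (c _))) hj,
    totalDeriv_add ((hF.two k i).mul (c _)) ((hF.one i).mul (c _)) hj,
    totalDeriv_add ((hF.one k).mul (c _)) (hF.zero.mul (c _)) hj,
    totalDeriv_mul_coord (hF.two k i) hj, totalDeriv_mul_coord (hF.one i) hj,
    totalDeriv_mul_coord (hF.one k) hj, totalDeriv_mul_coord hF.zero hj]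
  ring

theorem LineDiffOver2.mul_coord (hΩ : IsOpen Ω) (hF : LineDiffOver2 Ω F) (a : Fin 2)
    (J : Fin 3 → ℕ) : LineDiffOver2 Ω fun j => F j * j.2 a J := by
  have c := fun K => lineDiffOver_coord (Ω := Ω) a K
  exact ⟨hF.zero.mul (c J),
    fun i => (((hF.one i).mul (c _)).add (hF.zero.mul (c _))).congr hΩ
      fun _ hj => totalDeriv_mul_coord hF.zero hj i a J,
    fun k i => ((((hF.two k i).mul (c _)).add ((hF.one i).mul (c _))).add
      (((hF.one k).mul (c _)).add (hF.zero.mul (c _)))).congr hΩ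
      fun _ hj => totalDeriv_totalDeriv_mul_coord hΩ hF hj k i a J⟩

theorem totalDeriv_totalDeriv_comp_comm (hΩ : IsOpen Ω) (hf : ContDiffOn ℝ ∞ f Ω)
    (hj : basePoint j ∈ Ω) (k i : Fin 3) :
    totalDeriv k (totalDeriv i fun j => f (basePoint j)) j
      = totalDeriv i (totalDeriv k fun j => f (basePoint j)) j := by
  rw [totalDeriv_totalDeriv_comp hΩ hf hj, totalDeriv_totalDeriv_comp hΩ hf hj,
    dirDeriv_comm hΩ hf hj, add_comm (unitIndex i)]

/-- Each term of the explicit third-order formula is symmetric, by the symmetry of the derivatives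
of `f` and the commutativity of adding multi-indices. -/
theorem totalDeriv_totalDeriv_totalDeriv_comp_rotate (hΩ : IsOpen Ω) (hf : ContDiffOn ℝ ∞ f Ω)
    (hj : basePoint j ∈ Ω) (l k i : Fin 3) :
    totalDeriv l (totalDeriv k (totalDeriv i fun j => f (basePoint j))) j
      = totalDeriv k (totalDeriv i (totalDeriv l fun j => f (basePoint j))) j := by
  rw [totalDeriv_totalDeriv_totalDeriv_comp hΩ hf hj,
    totalDeriv_totalDeriv_totalDeriv_comp hΩ hf hj,
    dirDeriv_comm hΩ (hf.dirDeriv hΩ (totalVec i j)) hj (totalVec l j) (totalVec k j),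
    dirDeriv_congr hΩ (fun q hq => dirDeriv_comm hΩ hf hq (totalVec l j) (totalVec i j))
      (totalVec k j) hj,
    dirDeriv_comm hΩ hf hj _ (totalVec i j), dirDeriv_comm hΩ hf hj (totalVec l j),
    add_comm (unitIndex l) (unitIndex i), add_comm (unitIndex l) (unitIndex k),
    add_assoc (unitIndex i), add_assoc (unitIndex i), add_comm (unitIndex k) (unitIndex l)]
  ring

end ThirdOrder

/-! ### First-order and third-order coefficients of the prolongation. -/

section Prolongation

variable {Ω : Set PhaseSpace} {X : PhaseSpace → PhaseSpace} {j : JetSpace}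

/-- The component of a vector field along the `m`-th independent variable. -/
def horComp (X : PhaseSpace → PhaseSpace) (m : Fin 3) : PhaseSpace → ℝ := fun p => (X p).1 m

/-- The component of a vector field along the `a`-th dependent variable. -/
def vertComp (X : PhaseSpace → PhaseSpace) (a : Fin 2) : PhaseSpace → ℝ := fun p => (X p).2 a

theorem contDiffOn_horComp (hX : ContDiffOn ℝ ∞ X Ω) (m : Fin 3) :
    ContDiffOn ℝ ∞ (horComp X m) Ω :=
  contDiffOn_pi.1 hX.fst m

theorem contDiffOn_vertComp (hX : ContDiffOn ℝ ∞ X Ω) (a : Fin 2) :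
    ContDiffOn ℝ ∞ (vertComp X a) Ω :=
  contDiffOn_pi.1 hX.snd a

theorem characteristic_eq (X : PhaseSpace → PhaseSpace) (a : Fin 2) :
    characteristic X a = fun j => vertComp X a (basePoint j)
      - horComp X 0 (basePoint j) * j.2 a (unitIndex 0)
      - horComp X 1 (basePoint j) * j.2 a (unitIndex 1)
      - horComp X 2 (basePoint j) * j.2 a (unitIndex 2) := by
  funext j
  simp only [characteristic, Fin.sum_univ_three, vertComp, horComp]
  ring

theorem prolongation_first (hΩ : IsOpen Ω) (hX : ContDiffOn ℝ ∞ X Ω) (hj : basePoint j ∈ Ω)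
    (a : Fin 2) (i : Fin 3) :
    (prolongation X j).2 a (unitIndex i)
      = dirDeriv (totalVec i j) (vertComp X a) (basePoint j)
        - ∑ m, dirDeriv (totalVec i j) (horComp X m) (basePoint j) * j.2 a (unitIndex m) := by
  have h0 : totalDerivMulti (unitIndex i) (characteristic X a)
      = totalDeriv i (characteristic X a) := by
    fin_cases i <;> simp [totalDerivMulti, unitIndex]
  have hφ := lineDiffOver_comp_basePoint hΩ (contDiffOn_vertComp hX a)
  have hξ := fun m => lineDiffOver_comp_basePoint hΩ (contDiffOn_horComp hX m)
  have c := fun K => lineDiffOver_coord (Ω := Ω) a K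
  simp only [prolongation]
  rw [h0, characteristic_eq,
    totalDeriv_sub ((hφ.sub ((hξ 0).mul (c _))).sub ((hξ 1).mul (c _))) ((hξ 2).mul (c _)) hj,
    totalDeriv_sub (hφ.sub ((hξ 0).mul (c _))) ((hξ 1).mul (c _)) hj,
    totalDeriv_sub hφ ((hξ 0).mul (c _)) hj,
    totalDeriv_mul_coord (hξ 0) hj, totalDeriv_mul_coord (hξ 1) hj,
    totalDeriv_mul_coord (hξ 2) hj,
    totalDeriv_comp_basePoint hΩ (contDiffOn_vertComp hX a) hj,
    totalDeriv_comp_basePoint hΩ (contDiffOn_horComp hX 0) hj,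
    totalDeriv_comp_basePoint hΩ (contDiffOn_horComp hX 1) hj,
    totalDeriv_comp_basePoint hΩ (contDiffOn_horComp hX 2) hj]
  simp only [Fin.sum_univ_three, add_comm (unitIndex i), horComp]
  ring

/-- Expanding by Leibniz, the fourth-order derivatives of u^a in D³Q_a cancel against the transport
term of the prolongation. -/
theorem totalDeriv_totalDeriv_totalDeriv_characteristic (hΩ : IsOpen Ω)
    (hX : ContDiffOn ℝ ∞ X Ω) (hj : basePoint j ∈ Ω) (a : Fin 2) (l k i : Fin 3) :
    totalDeriv l (totalDeriv k (totalDeriv i (characteristic X a))) j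
      + ∑ m, horComp X m (basePoint j) *
          j.2 a (unitIndex m + unitIndex i + unitIndex k + unitIndex l)
      = totalDeriv l (totalDeriv k (totalDeriv i fun j => vertComp X a (basePoint j))) j
        - ∑ m, (totalDeriv l (totalDeriv k (totalDeriv i fun j => horComp X m (basePoint j))) j
            * j.2 a (unitIndex m)
          + totalDeriv k (totalDeriv i fun j => horComp X m (basePoint j)) j
            * j.2 a (unitIndex m + unitIndex l)
          + totalDeriv l (totalDeriv i fun j => horComp X m (basePoint j)) j
            * j.2 a (unitIndex m + unitIndex k)
          + totalDeriv l (totalDeriv k fun j => horComp X m (basePoint j)) j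
            * j.2 a (unitIndex m + unitIndex i)
          + totalDeriv i (fun j => horComp X m (basePoint j)) j
            * j.2 a (unitIndex m + unitIndex k + unitIndex l)
          + totalDeriv k (fun j => horComp X m (basePoint j)) j
            * j.2 a (unitIndex m + unitIndex i + unitIndex l)
          + totalDeriv l (fun j => horComp X m (basePoint j)) j
            * j.2 a (unitIndex m + unitIndex i + unitIndex k)) := by
  have hφ := lineDiffOver2_comp_basePoint hΩ (contDiffOn_vertComp hX a)
  have hξ := fun m => lineDiffOver2_comp_basePoint hΩ (contDiffOn_horComp hX m)
  have hp := fun m => (hξ m).mul_coord hΩ a (unitIndex m)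
  rw [characteristic_eq,
    totalDeriv_totalDeriv_totalDeriv_sub hΩ ((hφ.sub hΩ (hp 0)).sub hΩ (hp 1)) (hp 2) hj,
    totalDeriv_totalDeriv_totalDeriv_sub hΩ (hφ.sub hΩ (hp 0)) (hp 1) hj,
    totalDeriv_totalDeriv_totalDeriv_sub hΩ hφ (hp 0) hj,
    totalDeriv_totalDeriv_totalDeriv_mul_coord hΩ (hξ 0) hj,
    totalDeriv_totalDeriv_totalDeriv_mul_coord hΩ (hξ 1) hj,
    totalDeriv_totalDeriv_totalDeriv_mul_coord hΩ (hξ 2) hj]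
  simp only [Fin.sum_univ_three]
  ring

theorem prolongation_third (hΩ : IsOpen Ω) (hX : ContDiffOn ℝ ∞ X Ω) (hj : basePoint j ∈ Ω)
    (a : Fin 2) {k : Fin 3} (hk : k ≠ 2) (i : Fin 3) :
    (prolongation X j).2 a (unitIndex k + unitIndex k + unitIndex i)
      = totalDeriv k (totalDeriv k (totalDeriv i fun j => vertComp X a (basePoint j))) j
        - ∑ m, (totalDeriv k (totalDeriv k (totalDeriv i fun j => horComp X m (basePoint j))) j
            * j.2 a (unitIndex m)
          + totalDeriv k (totalDeriv k fun j => horComp X m (basePoint j)) j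
            * j.2 a (unitIndex m + unitIndex i)
          + 2 * totalDeriv k (totalDeriv i fun j => horComp X m (basePoint j)) j
            * j.2 a (unitIndex m + unitIndex k)
          + 2 * dirDeriv (totalVec k j) (horComp X m) (basePoint j)
            * j.2 a (unitIndex m + unitIndex k + unitIndex i)
          + dirDeriv (totalVec i j) (horComp X m) (basePoint j)
            * j.2 a (unitIndex m + unitIndex k + unitIndex k)) := by
  -- `totalDerivMulti` applies the derivatives in a fixed order; the second form is needed for k =
  -- 1, i = 0, where D_x is outermost.
  have h0 : totalDerivMulti (unitIndex k + unitIndex k + unitIndex i) (characteristic X a)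
        = totalDeriv k (totalDeriv k (totalDeriv i (characteristic X a)))
      ∨ totalDerivMulti (unitIndex k + unitIndex k + unitIndex i) (characteristic X a)
        = totalDeriv i (totalDeriv k (totalDeriv k (characteristic X a))) := by
    fin_cases k
    · left
      fin_cases i <;> simp [totalDerivMulti, unitIndex]
    · fin_cases i
      · right; simp [totalDerivMulti, unitIndex]
      · left; simp [totalDerivMulti, unitIndex]
      · left; simp [totalDerivMulti, unitIndex]
    · exact absurd rfl hk
  simp only [prolongation, ← totalDeriv_comp_basePoint hΩ (contDiffOn_horComp hX _) hj]
  have e1 : ∀ m, unitIndex k + unitIndex k + unitIndex i + unitIndex m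
      = unitIndex m + unitIndex i + unitIndex k + unitIndex k := fun m => by abel
  have e2 : ∀ m, unitIndex m + unitIndex k + unitIndex i
      = unitIndex m + unitIndex i + unitIndex k := fun m => by abel
  have e3 : ∀ m, unitIndex m + unitIndex k + unitIndex k + unitIndex i
      = unitIndex m + unitIndex i + unitIndex k + unitIndex k := fun m => by abel
  rcases h0 with h0 | h0
  · have h := totalDeriv_totalDeriv_totalDeriv_characteristic hΩ hX hj a k k i
    rw [h0]
    simp only [e1]
    refine Eq.trans h (congrArg₂ _ rfl (Finset.sum_congr rfl fun m _ => ?_))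
    rw [e2]
    ring
  · have h := totalDeriv_totalDeriv_totalDeriv_characteristic hΩ hX hj a i k k
    rw [h0]
    simp only [e3, totalDeriv_totalDeriv_totalDeriv_comp_rotate hΩ (contDiffOn_vertComp hX a) hj i,
      totalDeriv_totalDeriv_totalDeriv_comp_rotate hΩ (contDiffOn_horComp hX _) hj i,
      totalDeriv_totalDeriv_comp_comm hΩ (contDiffOn_horComp hX _) hj i] at h
    simp only [e1]
    refine Eq.trans h (congrArg₂ _ rfl (Finset.sum_congr rfl fun m _ => ?_))
    rw [e2]
    ring

end Prolongation

/-! ### The equations in jet coordinates and their linearizations. -/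

section Equations

/-- The first derivative coordinate `u^a_i`. -/
def firstCoord (a : Fin 2) (i : Fin 3) (j : JetSpace) : ℝ := j.2 a (unitIndex i)

/-- The coordinate expression of `D_i ∇² u^a`. -/
def lapCoord (a : Fin 2) (i : Fin 3) (j : JetSpace) : ℝ :=
  j.2 a (unitIndex 0 + unitIndex 0 + unitIndex i) + j.2 a (unitIndex 1 + unitIndex 1 + unitIndex i)

variable {F G : JetSpace → ℝ} {F' G' : ℝ} {j v : JetSpace}

theorem HasLineDerivAt.jet_mul (hF : HasLineDerivAt ℝ F F' j v) (hG : HasLineDerivAt ℝ G G' j v) :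
    HasLineDerivAt ℝ (fun j => F j * G j) (F' * G j + F j * G') j v :=
  (HasDerivAt.fun_mul hF hG).congr_deriv (by simp)

theorem HasLineDerivAt.jet_add (hF : HasLineDerivAt ℝ F F' j v) (hG : HasLineDerivAt ℝ G G' j v) :
    HasLineDerivAt ℝ (fun j => F j + G j) (F' + G') j v :=
  HasDerivAt.fun_add hF hG

theorem HasLineDerivAt.jet_sub (hF : HasLineDerivAt ℝ F F' j v) (hG : HasLineDerivAt ℝ G G' j v) :
    HasLineDerivAt ℝ (fun j => F j - G j) (F' - G') j v :=
  HasDerivAt.fun_sub hF hG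

theorem hasLineDerivAt_firstCoord (a : Fin 2) (i : Fin 3) :
    HasLineDerivAt ℝ (firstCoord a i) (firstCoord a i v) j v :=
  hasLineDerivAt_coord _ _ _ _

theorem hasLineDerivAt_lapCoord (a : Fin 2) (i : Fin 3) :
    HasLineDerivAt ℝ (lapCoord a i) (lapCoord a i v) j v :=
  (hasLineDerivAt_coord _ _ _ _).jet_add (hasLineDerivAt_coord _ _ _ _)

theorem totalDeriv_uCoord (i : Fin 3) : totalDeriv i uCoord = firstCoord 0 i := by
  unfold uCoord
  rw [totalDeriv_coord]
  simp only [zero_add]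
  rfl

theorem totalDeriv_vCoord (i : Fin 3) : totalDeriv i vCoord = firstCoord 1 i := by
  unfold vCoord
  rw [totalDeriv_coord]
  simp only [zero_add]
  rfl

theorem hasLineDerivAt_laplacian2_coord (a : Fin 2) :
    HasLineDerivAt ℝ (laplacian2 fun j => j.2 a 0)
      (v.2 a (unitIndex 0 + unitIndex 0) + v.2 a (unitIndex 1 + unitIndex 1)) j v := by
  have : (laplacian2 fun j => j.2 a 0) = fun j => j.2 a (unitIndex 0 + unitIndex 0)
      + j.2 a (unitIndex 1 + unitIndex 1) := by
    funext j
    simp [laplacian2, totalDeriv_coord]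
  rw [this]
  exact (hasLineDerivAt_coord _ _ _ _).jet_add (hasLineDerivAt_coord _ _ _ _)

theorem totalDeriv_laplacian2_uCoord (i : Fin 3) :
    totalDeriv i (laplacian2 uCoord) = lapCoord 0 i :=
  funext fun _ => (hasLineDerivAt_laplacian2_coord 0).lineDeriv

theorem totalDeriv_laplacian2_vCoord (i : Fin 3) :
    totalDeriv i (laplacian2 vCoord) = lapCoord 1 i :=
  funext fun _ => (hasLineDerivAt_laplacian2_coord 1).lineDeriv

theorem totalDeriv_uCoord_sub_laplacian2 (i : Fin 3) :
    totalDeriv i (uCoord - laplacian2 uCoord) = fun j => firstCoord 0 i j - lapCoord 0 i j := by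
  funext j
  have := ((hasLineDerivAt_coord 0 0 j _).jet_sub
    (hasLineDerivAt_laplacian2_coord (j := j) 0)).lineDeriv
    (v := (Pi.single i 1, fun a J => j.2 a (J + unitIndex i)))
  refine Eq.trans this ?_
  simp [firstCoord, lapCoord]

theorem constraintUV_eq : constraintUV = fun j =>
    firstCoord 0 0 j * lapCoord 1 1 j - lapCoord 1 0 j * firstCoord 0 1 j := by
  simp only [constraintUV, bracket, totalDeriv_uCoord, totalDeriv_laplacian2_vCoord]
  rfl

theorem constraintUU_eq : constraintUU = fun j =>
    firstCoord 0 0 j * lapCoord 0 1 j - lapCoord 0 0 j * firstCoord 0 1 j := by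
  simp only [constraintUU, bracket, totalDeriv_uCoord, totalDeriv_laplacian2_uCoord]
  rfl

theorem truncatedMagneticEq_eq : truncatedMagneticEq = fun j =>
    firstCoord 0 2 j - lapCoord 0 2 j
      - ((firstCoord 0 0 j - lapCoord 0 0 j) * firstCoord 1 1 j
        - firstCoord 1 0 j * (firstCoord 0 1 j - lapCoord 0 1 j)) := by
  simp only [truncatedMagneticEq, bracket, totalDeriv_vCoord, totalDeriv_uCoord_sub_laplacian2]
  rfl

theorem magneticEq_eq : magneticEq = fun j => truncatedMagneticEq j + constraintUV j := rfl

theorem vorticityEq_eq : vorticityEq = fun j =>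
    lapCoord 1 2 j - (firstCoord 0 0 j * lapCoord 0 1 j - lapCoord 0 0 j * firstCoord 0 1 j)
      + (firstCoord 1 0 j * lapCoord 1 1 j - lapCoord 1 0 j * firstCoord 1 1 j) := by
  simp only [vorticityEq, bracket, totalDeriv_vCoord, totalDeriv_uCoord,
    totalDeriv_laplacian2_vCoord, totalDeriv_laplacian2_uCoord]
  rfl

theorem hasLineDerivAt_constraintUV : HasLineDerivAt ℝ constraintUV
    (firstCoord 0 0 v * lapCoord 1 1 j + firstCoord 0 0 j * lapCoord 1 1 v
      - (lapCoord 1 0 v * firstCoord 0 1 j + lapCoord 1 0 j * firstCoord 0 1 v)) j v := by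
  rw [constraintUV_eq]
  exact ((hasLineDerivAt_firstCoord 0 0).jet_mul (hasLineDerivAt_lapCoord 1 1)).jet_sub
    ((hasLineDerivAt_lapCoord 1 0).jet_mul (hasLineDerivAt_firstCoord 0 1))

theorem hasLineDerivAt_constraintUU : HasLineDerivAt ℝ constraintUU
    (firstCoord 0 0 v * lapCoord 0 1 j + firstCoord 0 0 j * lapCoord 0 1 v
      - (lapCoord 0 0 v * firstCoord 0 1 j + lapCoord 0 0 j * firstCoord 0 1 v)) j v := by
  rw [constraintUU_eq]
  exact ((hasLineDerivAt_firstCoord 0 0).jet_mul (hasLineDerivAt_lapCoord 0 1)).jet_sub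
    ((hasLineDerivAt_lapCoord 0 0).jet_mul (hasLineDerivAt_firstCoord 0 1))

theorem hasLineDerivAt_truncatedMagneticEq : HasLineDerivAt ℝ truncatedMagneticEq
    (firstCoord 0 2 v - lapCoord 0 2 v
      - ((firstCoord 0 0 v - lapCoord 0 0 v) * firstCoord 1 1 j + (firstCoord 0 0 j - lapCoord 0 0 j) * firstCoord 1 1 v
        - (firstCoord 1 0 v * (firstCoord 0 1 j - lapCoord 0 1 j)
          + firstCoord 1 0 j * (firstCoord 0 1 v - lapCoord 0 1 v)))) j v := by
  rw [truncatedMagneticEq_eq]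
  exact ((hasLineDerivAt_firstCoord 0 2).jet_sub (hasLineDerivAt_lapCoord 0 2)).jet_sub
    ((((hasLineDerivAt_firstCoord 0 0).jet_sub (hasLineDerivAt_lapCoord 0 0)).jet_mul
      (hasLineDerivAt_firstCoord 1 1)).jet_sub
    ((hasLineDerivAt_firstCoord 1 0).jet_mul
      ((hasLineDerivAt_firstCoord 0 1).jet_sub (hasLineDerivAt_lapCoord 0 1))))

theorem lineDeriv_magneticEq : lineDeriv ℝ magneticEq j v
    = lineDeriv ℝ truncatedMagneticEq j v + lineDeriv ℝ constraintUV j v := by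
  rw [hasLineDerivAt_truncatedMagneticEq.lineDeriv, hasLineDerivAt_constraintUV.lineDeriv]
  exact (hasLineDerivAt_truncatedMagneticEq.jet_add hasLineDerivAt_constraintUV).lineDeriv

theorem hasLineDerivAt_vorticityEq : HasLineDerivAt ℝ vorticityEq
    (lapCoord 1 2 v
      - (firstCoord 0 0 v * lapCoord 0 1 j + firstCoord 0 0 j * lapCoord 0 1 v
        - (lapCoord 0 0 v * firstCoord 0 1 j + lapCoord 0 0 j * firstCoord 0 1 v))
      + (firstCoord 1 0 v * lapCoord 1 1 j + firstCoord 1 0 j * lapCoord 1 1 v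
        - (lapCoord 1 0 v * firstCoord 1 1 j + lapCoord 1 0 j * firstCoord 1 1 v))) j v := by
  rw [vorticityEq_eq]
  exact ((hasLineDerivAt_lapCoord 1 2).jet_sub
    (((hasLineDerivAt_firstCoord 0 0).jet_mul (hasLineDerivAt_lapCoord 0 1)).jet_sub
      ((hasLineDerivAt_lapCoord 0 0).jet_mul (hasLineDerivAt_firstCoord 0 1)))).jet_add
    (((hasLineDerivAt_firstCoord 1 0).jet_mul (hasLineDerivAt_lapCoord 1 1)).jet_sub
      ((hasLineDerivAt_lapCoord 1 0).jet_mul (hasLineDerivAt_firstCoord 1 1)))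

end Equations

/-! ### Prolongation coefficients split along `u` and `v`. -/

section Expansion

variable {Ω : Set PhaseSpace} {f : PhaseSpace → ℝ} {X : PhaseSpace → PhaseSpace} {j : JetSpace}

/-- The derivative along the first dependent variable `u`. -/
noncomputable abbrev dU (f : PhaseSpace → ℝ) : PhaseSpace → ℝ := dirDeriv (vert ![1, 0]) f

/-- The derivative along the second dependent variable `v`. -/
noncomputable abbrev dV (f : PhaseSpace → ℝ) : PhaseSpace → ℝ := dirDeriv (vert ![0, 1]) f

theorem totalDeriv_totalDeriv_comp_expand (hΩ : IsOpen Ω) (hf : ContDiffOn ℝ ∞ f Ω)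
    (hj : basePoint j ∈ Ω) (k i : Fin 3) :
    totalDeriv k (totalDeriv i fun j => f (basePoint j)) j
      = dirDeriv (totalVec k j) (dirDeriv (totalVec i j) f) (basePoint j)
        + (j.2 0 (unitIndex i + unitIndex k) * dU f (basePoint j)
          + j.2 1 (unitIndex i + unitIndex k) * dV f (basePoint j)) := by
  rw [totalDeriv_totalDeriv_comp hΩ hf hj, dirDeriv_vert]

theorem totalDeriv_totalDeriv_totalDeriv_comp_expand (hΩ : IsOpen Ω) (hf : ContDiffOn ℝ ∞ f Ω)
    (hj : basePoint j ∈ Ω) (k i : Fin 3) :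
    totalDeriv k (totalDeriv k (totalDeriv i fun j => f (basePoint j))) j
      = dirDeriv (totalVec k j) (dirDeriv (totalVec k j) (dirDeriv (totalVec i j) f)) (basePoint j)
        + (j.2 0 (unitIndex k + unitIndex k) * dirDeriv (totalVec i j) (dU f) (basePoint j)
          + j.2 1 (unitIndex k + unitIndex k) * dirDeriv (totalVec i j) (dV f) (basePoint j))
        + 2 * (j.2 0 (unitIndex i + unitIndex k) * dirDeriv (totalVec k j) (dU f) (basePoint j)
          + j.2 1 (unitIndex i + unitIndex k) * dirDeriv (totalVec k j) (dV f) (basePoint j))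
        + (j.2 0 (unitIndex i + unitIndex k + unitIndex k) * dU f (basePoint j)
          + j.2 1 (unitIndex i + unitIndex k + unitIndex k) * dV f (basePoint j)) := by
  rw [totalDeriv_totalDeriv_totalDeriv_comp hΩ hf hj, dirDeriv_vert, dirDeriv_comm hΩ hf hj _
    (totalVec i j), dirDeriv_comm hΩ hf hj _ (totalVec i j),
    dirDeriv_dirDeriv_vert hΩ hf hj (totalVec k j), dirDeriv_vert]
  ring

theorem firstCoord_prolongation (hΩ : IsOpen Ω) (hX : ContDiffOn ℝ ∞ X Ω) (hj : basePoint j ∈ Ω)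
    (a : Fin 2) (i : Fin 3) :
    firstCoord a i (prolongation X j)
      = dirDeriv (totalVec i j) (vertComp X a) (basePoint j)
        - (dirDeriv (totalVec i j) (horComp X 0) (basePoint j) * j.2 a (unitIndex 0)
          + dirDeriv (totalVec i j) (horComp X 1) (basePoint j) * j.2 a (unitIndex 1)
          + dirDeriv (totalVec i j) (horComp X 2) (basePoint j) * j.2 a (unitIndex 2)) := by
  rw [firstCoord, prolongation_first hΩ hX hj, Fin.sum_univ_three]

end Expansion

/-! ### Jets at which all first derivatives of ∇²u and ∇²v vanish. -/

section TestJets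

/-- Derivative coordinates of a jet with vanishing first-order derivatives of `∇² u` and `∇² v`. -/
def harmonicCoord (p : PhaseSpace) (w₀ w₁ δ ε : Fin 2 → ℝ) (s : Fin 4 → ℝ) :
    Fin 2 → ℕ → ℕ → ℕ → ℝ
  | a, 0, 0, 0 => p.2 a
  | a, 1, 0, 0 => w₀ a
  | a, 0, 1, 0 => w₁ a
  -- The truncated first equation, with D_i∇²u = 0, prescribes u_t = u_x v_y - v_x u_y. The other
  -- equations and the constraints then hold trivially.
  | 0, 0, 0, 1 => w₀ 0 * w₁ 1 - w₀ 1 * w₁ 0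
  | a, 1, 0, 1 => δ a
  | a, 0, 1, 1 => ε a
  | 1, 1, 0, 2 => s 0
  | 1, 0, 1, 2 => s 1
  | 1, 1, 1, 1 => s 2
  | 1, 2, 0, 1 => s 3
  -- The opposite sign to v_xxt keeps D_t∇²v = 0.
  | 1, 0, 2, 1 => -s 3
  | _, _, _, _ => 0

/-- A jet with vanishing first-order derivatives of `∇² u` and `∇² v`. -/
def harmonicJet (p : PhaseSpace) (w₀ w₁ δ ε : Fin 2 → ℝ) (s : Fin 4 → ℝ) : JetSpace :=
  (p.1, fun a J => harmonicCoord p w₀ w₁ δ ε s a (J 0) (J 1) (J 2))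

variable (p : PhaseSpace) (w₀ w₁ δ ε : Fin 2 → ℝ) (s : Fin 4 → ℝ)

theorem basePoint_harmonicJet : basePoint (harmonicJet p w₀ w₁ δ ε s) = p := by
  refine Prod.ext rfl (funext fun a => ?_)
  fin_cases a <;> rfl

theorem totalVec_zero_harmonicJet :
    totalVec 0 (harmonicJet p w₀ w₁ δ ε s) = hor 0 + vert w₀ := by
  refine congrArg (hor 0 + vert ·) (funext fun a => ?_)
  fin_cases a <;> rfl

theorem totalVec_one_harmonicJet :
    totalVec 1 (harmonicJet p w₀ w₁ δ ε s) = hor 1 + vert w₁ := by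
  refine congrArg (hor 1 + vert ·) (funext fun a => ?_)
  fin_cases a <;> rfl

theorem totalVec_two_harmonicJet :
    totalVec 2 (harmonicJet p w₀ w₁ δ ε s)
      = hor 2 + vert ![w₀ 0 * w₁ 1 - w₀ 1 * w₁ 0, 0] := by
  refine congrArg (hor 2 + vert ·) (funext fun a => ?_)
  fin_cases a <;> rfl

theorem harmonicJet_coord (a : Fin 2) (J : Fin 3 → ℕ) : (harmonicJet p w₀ w₁ δ ε s).2 a J
    = harmonicCoord p w₀ w₁ δ ε s a (J 0) (J 1) (J 2) := rfl

theorem lapCoord_harmonicJet (a : Fin 2) (i : Fin 3) :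
    lapCoord a i (harmonicJet p w₀ w₁ δ ε s) = 0 := by
  fin_cases a <;> fin_cases i <;>
    simp [lapCoord, harmonicJet_coord, unitIndex, harmonicCoord]

theorem firstCoord_zero_harmonicJet (a : Fin 2) :
    firstCoord a 0 (harmonicJet p w₀ w₁ δ ε s) = w₀ a := by
  fin_cases a <;> rfl

theorem firstCoord_one_harmonicJet (a : Fin 2) :
    firstCoord a 1 (harmonicJet p w₀ w₁ δ ε s) = w₁ a := by
  fin_cases a <;> rfl

theorem firstCoord_two_harmonicJet :
    firstCoord 0 2 (harmonicJet p w₀ w₁ δ ε s) = w₀ 0 * w₁ 1 - w₀ 1 * w₁ 0 := rfl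

end TestJets

/-! ### The horizontal components: conformality from third-order derivatives. -/

section Necessity

/-- The vector field `X` satisfies, at the jets over `Ω` that solve the truncated system and both
constraints, the linearized vorticity equation and the linearization of the first equation, to which
the multiple `μ` of the first constraint is added. -/
def IsWeakSymmetry (Ω : Set PhaseSpace) (μ : ℝ) (X : PhaseSpace → PhaseSpace) : Prop :=
  ∀ j, basePoint j ∈ Ω → truncatedMagneticEq j = 0 → vorticityEq j = 0 → constraintUV j = 0 →
    constraintUU j = 0 → lineDeriv ℝ vorticityEq j (prolongation X j) = 0 ∧
      lineDeriv ℝ truncatedMagneticEq j (prolongation X j)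
        + μ * lineDeriv ℝ constraintUV j (prolongation X j) = 0

variable {Ω : Set PhaseSpace} {μ : ℝ} {X : PhaseSpace → PhaseSpace} {p : PhaseSpace}

theorem IsWeakSymmetry.at_harmonicJet (H : IsWeakSymmetry Ω μ X) (hp : p ∈ Ω)
    (w₀ w₁ δ ε : Fin 2 → ℝ) (s : Fin 4 → ℝ) :
    lapCoord 1 2 (prolongation X (harmonicJet p w₀ w₁ δ ε s))
      - (w₀ 0 * lapCoord 0 1 (prolongation X (harmonicJet p w₀ w₁ δ ε s))
        - lapCoord 0 0 (prolongation X (harmonicJet p w₀ w₁ δ ε s)) * w₁ 0)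
      + (w₀ 1 * lapCoord 1 1 (prolongation X (harmonicJet p w₀ w₁ δ ε s))
        - lapCoord 1 0 (prolongation X (harmonicJet p w₀ w₁ δ ε s)) * w₁ 1) = 0 ∧
    firstCoord 0 2 (prolongation X (harmonicJet p w₀ w₁ δ ε s))
      - lapCoord 0 2 (prolongation X (harmonicJet p w₀ w₁ δ ε s))
      - ((firstCoord 0 0 (prolongation X (harmonicJet p w₀ w₁ δ ε s))
          - lapCoord 0 0 (prolongation X (harmonicJet p w₀ w₁ δ ε s))) * w₁ 1
        + w₀ 0 * firstCoord 1 1 (prolongation X (harmonicJet p w₀ w₁ δ ε s))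
        - (firstCoord 1 0 (prolongation X (harmonicJet p w₀ w₁ δ ε s)) * w₁ 0
          + w₀ 1 * (firstCoord 0 1 (prolongation X (harmonicJet p w₀ w₁ δ ε s))
            - lapCoord 0 1 (prolongation X (harmonicJet p w₀ w₁ δ ε s)))))
      + μ * (w₀ 0 * lapCoord 1 1 (prolongation X (harmonicJet p w₀ w₁ δ ε s))
        - lapCoord 1 0 (prolongation X (harmonicJet p w₀ w₁ δ ε s)) * w₁ 0) = 0 := by
  have h := H (harmonicJet p w₀ w₁ δ ε s) (by rwa [basePoint_harmonicJet])
    (by simp only [truncatedMagneticEq_eq, lapCoord_harmonicJet, firstCoord_zero_harmonicJet,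
          firstCoord_one_harmonicJet, firstCoord_two_harmonicJet]
        ring)
    (by simp [vorticityEq_eq, lapCoord_harmonicJet])
    (by simp [constraintUV_eq, lapCoord_harmonicJet])
    (by simp [constraintUU_eq, lapCoord_harmonicJet])
  rw [hasLineDerivAt_vorticityEq.lineDeriv, hasLineDerivAt_truncatedMagneticEq.lineDeriv,
    hasLineDerivAt_constraintUV.lineDeriv] at h
  simp only [lapCoord_harmonicJet, firstCoord_zero_harmonicJet, firstCoord_one_harmonicJet] at h
  obtain ⟨h1, h2⟩ := h
  exact ⟨by linear_combination h1, by linear_combination h2⟩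

/-- The parameters `s` are the derivatives v_xtt, v_ytt, v_xyt and v_xxt = -v_yyt, which the
equations leave free, so the part of the linearized vorticity equation that is linear in them must
vanish. -/
theorem IsWeakSymmetry.third_order_coefficients (hΩ : IsOpen Ω) (hX : ContDiffOn ℝ ∞ X Ω)
    (H : IsWeakSymmetry Ω μ X) (hp : p ∈ Ω) (w₀ w₁ : Fin 2 → ℝ) (s : Fin 4 → ℝ) :
    dirDeriv (hor 0 + vert w₀) (horComp X 2) p * s 0
      + dirDeriv (hor 1 + vert w₁) (horComp X 2) p * s 1
      + (dirDeriv (hor 0 + vert w₀) (horComp X 1) p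
        + dirDeriv (hor 1 + vert w₁) (horComp X 0) p) * s 2
      + (dirDeriv (hor 0 + vert w₀) (horComp X 0) p
        - dirDeriv (hor 1 + vert w₁) (horComp X 1) p) * s 3
      + (dirDeriv (hor 0 + vert w₀) (horComp X 2) p * w₀ 1
        - dirDeriv (hor 1 + vert w₁) (horComp X 2) p * w₁ 1) * s 2
      - (dirDeriv (hor 0 + vert w₀) (horComp X 2) p * w₁ 1
        + dirDeriv (hor 1 + vert w₁) (horComp X 2) p * w₀ 1) * s 3 = 0 := by
  have h1 := (H.at_harmonicJet hp w₀ w₁ 0 0 s).1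
  -- Subtracting the case `s = 0` isolates the part linear in `s`; it carries an overall factor -2.
  have h0 := (H.at_harmonicJet hp w₀ w₁ 0 0 0).1
  have hs : ∀ s, basePoint (harmonicJet p w₀ w₁ 0 0 s) ∈ Ω :=
    fun s => by rwa [basePoint_harmonicJet]
  have n0 : (0 : Fin 3) ≠ 2 := by decide
  have n1 : (1 : Fin 3) ≠ 2 := by decide
  simp only [lapCoord, prolongation_third hΩ hX (hs _) _ n0,
    prolongation_third hΩ hX (hs _) _ n1, Fin.sum_univ_three,
    totalDeriv_totalDeriv_comp_expand hΩ (contDiffOn_horComp hX _) (hs _),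
    totalDeriv_totalDeriv_totalDeriv_comp_expand hΩ (contDiffOn_horComp hX _) (hs _),
    totalDeriv_totalDeriv_totalDeriv_comp_expand hΩ (contDiffOn_vertComp hX _) (hs _),
    basePoint_harmonicJet, totalVec_zero_harmonicJet, totalVec_one_harmonicJet,
    totalVec_two_harmonicJet, harmonicJet_coord] at h1 h0
  simp [unitIndex, harmonicCoord, -dirDeriv_add_vec] at h1 h0
  linear_combination (h0 - h1) / 2

/-- The conditions that the horizontal components do not depend on `(u, v)`, that the time component
depends on time only, and that the `(x, y)` components form a conformal vector field. -/
structure IsConformal (Ω : Set PhaseSpace) (X : PhaseSpace → PhaseSpace) : Prop where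
  vert : ∀ p ∈ Ω, ∀ m w, dirDeriv (vert w) (horComp X m) p = 0
  time_x : ∀ p ∈ Ω, dirDeriv (hor 0) (horComp X 2) p = 0
  time_y : ∀ p ∈ Ω, dirDeriv (hor 1) (horComp X 2) p = 0
  diag : ∀ p ∈ Ω, dirDeriv (hor 1) (horComp X 1) p = dirDeriv (hor 0) (horComp X 0) p
  skew : ∀ p ∈ Ω, dirDeriv (hor 1) (horComp X 0) p = -dirDeriv (hor 0) (horComp X 1) p

theorem IsWeakSymmetry.isConformal (hΩ : IsOpen Ω) (hX : ContDiffOn ℝ ∞ X Ω)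
    (H : IsWeakSymmetry Ω μ X) : IsConformal Ω X := by
  -- The first two choices of `s` give D_xτ = D_yτ = 0. With these the products with `w₀ 1` and `w₁
  -- 1` disappear, and the last two choices give D_xη + D_yξ = 0 and D_xξ - D_yη = 0.
  have t0 : ∀ p ∈ Ω, ∀ w, dirDeriv (hor 0 + _root_.vert w) (horComp X 2) p = 0 := fun p hp w => by
    simpa [-dirDeriv_add_vec] using H.third_order_coefficients hΩ hX hp w 0 ![1, 0, 0, 0]
  have t1 : ∀ p ∈ Ω, ∀ w, dirDeriv (hor 1 + _root_.vert w) (horComp X 2) p = 0 := fun p hp w => by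
    simpa [-dirDeriv_add_vec] using H.third_order_coefficients hΩ hX hp 0 w ![0, 1, 0, 0]
  have t2 : ∀ p ∈ Ω, ∀ w₀ w₁, dirDeriv (hor 0 + _root_.vert w₀) (horComp X 1) p
      + dirDeriv (hor 1 + _root_.vert w₁) (horComp X 0) p = 0 := fun p hp w₀ w₁ => by
    simpa [-dirDeriv_add_vec, t0 p hp, t1 p hp] using
      H.third_order_coefficients hΩ hX hp w₀ w₁ ![0, 0, 1, 0]
  have t3 : ∀ p ∈ Ω, ∀ w₀ w₁, dirDeriv (hor 0 + _root_.vert w₀) (horComp X 0) p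
      - dirDeriv (hor 1 + _root_.vert w₁) (horComp X 1) p = 0 := fun p hp w₀ w₁ => by
    simpa [-dirDeriv_add_vec, t0 p hp, t1 p hp] using
      H.third_order_coefficients hΩ hX hp w₀ w₁ ![0, 0, 0, 1]
  simp only [dirDeriv_add_vec] at t0 t1 t2 t3
  refine ⟨fun p hp m w => ?_, fun p hp => by simpa using t0 p hp 0,
    fun p hp => by simpa using t1 p hp 0,
    fun p hp => ?_, fun p hp => ?_⟩
  -- Comparing an arbitrary `w` with `0` separates the vertical derivative from the horizontal one.
  · have a1 := t0 p hp w
    have a2 := t0 p hp 0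
    have b1 := t2 p hp w 0
    have b2 := t2 p hp 0 0
    have c1 := t3 p hp w 0
    have c2 := t3 p hp 0 0
    simp only [vert_zero, dirDeriv_zero_vec] at a1 a2 b1 b2 c1 c2
    fin_cases m <;> simp only [Fin.zero_eta, Fin.mk_one, Fin.reduceFinMk] <;> linarith
  · have := t3 p hp 0 0
    simp only [vert_zero, dirDeriv_zero_vec] at this
    linarith
  · have := t2 p hp 0 0
    simp only [vert_zero, dirDeriv_zero_vec] at this
    linarith

end Necessity

/-! ### Prolongation of conformal fields. -/

section Conformal

variable {Ω : Set PhaseSpace} {f : PhaseSpace → ℝ} {X : PhaseSpace → PhaseSpace} {j : JetSpace}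
  {p : PhaseSpace}

theorem dirDeriv_vert_dirDeriv_of_vert (hΩ : IsOpen Ω) (hf : ContDiffOn ℝ ∞ f Ω)
    (h : ∀ p ∈ Ω, ∀ w, dirDeriv (vert w) f p = 0) (v : PhaseSpace) :
    ∀ p ∈ Ω, ∀ w, dirDeriv (vert w) (dirDeriv v f) p = 0 := fun p hp w => by
  rw [dirDeriv_comm hΩ hf hp]
  exact dirDeriv_eq_zero_of_eqOn hΩ (fun q hq => h q hq w) v hp

theorem totalDeriv_comp_of_vert (hΩ : IsOpen Ω) (hf : ContDiffOn ℝ ∞ f Ω)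
    (h : ∀ p ∈ Ω, ∀ w, dirDeriv (vert w) f p = 0) (hj : basePoint j ∈ Ω) (i : Fin 3) :
    totalDeriv i (fun j => f (basePoint j)) j = dirDeriv (hor i) f (basePoint j) := by
  rw [totalDeriv_comp_basePoint hΩ hf hj, totalVec, dirDeriv_add_vec, h _ hj, add_zero]

theorem totalDeriv_totalDeriv_comp_of_vert (hΩ : IsOpen Ω) (hf : ContDiffOn ℝ ∞ f Ω)
    (h : ∀ p ∈ Ω, ∀ w, dirDeriv (vert w) f p = 0) (hj : basePoint j ∈ Ω) (k i : Fin 3) :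
    totalDeriv k (totalDeriv i fun j => f (basePoint j)) j
      = dirDeriv (hor k) (dirDeriv (hor i) f) (basePoint j) := by
  rw [totalDeriv_congr_over hΩ (fun j hj => totalDeriv_comp_of_vert hΩ hf h hj i) k hj,
    totalDeriv_comp_of_vert hΩ (hf.dirDeriv hΩ _) (dirDeriv_vert_dirDeriv_of_vert hΩ hf h _) hj]

theorem totalDeriv_totalDeriv_totalDeriv_comp_of_vert (hΩ : IsOpen Ω) (hf : ContDiffOn ℝ ∞ f Ω)
    (h : ∀ p ∈ Ω, ∀ w, dirDeriv (vert w) f p = 0) (hj : basePoint j ∈ Ω) (l k i : Fin 3) :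
    totalDeriv l (totalDeriv k (totalDeriv i fun j => f (basePoint j))) j
      = dirDeriv (hor l) (dirDeriv (hor k) (dirDeriv (hor i) f)) (basePoint j) := by
  rw [totalDeriv_congr_over hΩ (fun j hj => totalDeriv_totalDeriv_comp_of_vert hΩ hf h hj k i) l hj]
  have h1 := dirDeriv_vert_dirDeriv_of_vert hΩ hf h (hor i)
  rw [totalDeriv_comp_of_vert hΩ ((hf.dirDeriv hΩ _).dirDeriv hΩ _)
    (dirDeriv_vert_dirDeriv_of_vert hΩ (hf.dirDeriv hΩ _) h1 _) hj]

theorem dirDeriv_rotate (hΩ : IsOpen Ω) (hf : ContDiffOn ℝ ∞ f Ω) (hp : p ∈ Ω)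
    (v w : PhaseSpace) : dirDeriv w (dirDeriv w (dirDeriv v f)) p
      = dirDeriv v (dirDeriv w (dirDeriv w f)) p := by
  rw [dirDeriv_congr hΩ (fun q hq => dirDeriv_comm hΩ hf hq w v) w hp,
    dirDeriv_comm hΩ (hf.dirDeriv hΩ _) hp]

/-- Components of a solution of the Cauchy–Riemann equations are harmonic; the time component is
independent of x and y. -/
theorem IsConformal.harmonic (hΩ : IsOpen Ω) (hX : ContDiffOn ℝ ∞ X Ω) (hC : IsConformal Ω X)
    (hp : p ∈ Ω) (m : Fin 3) : dirDeriv (hor 0) (dirDeriv (hor 0) (horComp X m)) p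
      + dirDeriv (hor 1) (dirDeriv (hor 1) (horComp X m)) p = 0 := by
  have hξ := contDiffOn_horComp hX
  fin_cases m
  · have h1 := dirDeriv_congr hΩ hC.diag (hor 0) hp
    have h2 : dirDeriv (hor 1) (dirDeriv (hor 1) (horComp X 0)) p
        = dirDeriv (hor 1) (fun p => (-1) * dirDeriv (hor 0) (horComp X 1) p) p :=
      dirDeriv_congr hΩ (fun p hp => by rw [hC.skew p hp]; ring) (hor 1) hp
    rw [dirDeriv_const_mul hΩ ((hξ 1).dirDeriv hΩ _) hp] at h2
    have h3 := dirDeriv_comm hΩ (hξ 1) hp (hor 0) (hor 1)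
    simp only [Fin.zero_eta]
    linarith
  · have h1 := dirDeriv_congr hΩ hC.diag (hor 1) hp
    have h2 : dirDeriv (hor 0) (dirDeriv (hor 1) (horComp X 0)) p
        = dirDeriv (hor 0) (fun p => (-1) * dirDeriv (hor 0) (horComp X 1) p) p :=
      dirDeriv_congr hΩ (fun p hp => by rw [hC.skew p hp]; ring) (hor 0) hp
    rw [dirDeriv_const_mul hΩ ((hξ 1).dirDeriv hΩ _) hp] at h2
    have h3 := dirDeriv_comm hΩ (hξ 0) hp (hor 0) (hor 1)
    simp only [Fin.mk_one]
    linarith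
  · simp only [Fin.reduceFinMk]
    rw [dirDeriv_eq_zero_of_eqOn hΩ hC.time_x _ hp, dirDeriv_eq_zero_of_eqOn hΩ hC.time_y _ hp,
      add_zero]

theorem IsConformal.firstCoord_prolongation (hΩ : IsOpen Ω) (hX : ContDiffOn ℝ ∞ X Ω)
    (hC : IsConformal Ω X) (hj : basePoint j ∈ Ω) (a : Fin 2) (i : Fin 3) :
    firstCoord a i (prolongation X j) = dirDeriv (totalVec i j) (vertComp X a) (basePoint j)
      - (dirDeriv (hor i) (horComp X 0) (basePoint j) * firstCoord a 0 j
        + dirDeriv (hor i) (horComp X 1) (basePoint j) * firstCoord a 1 j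
        + dirDeriv (hor i) (horComp X 2) (basePoint j) * firstCoord a 2 j) := by
  rw [_root_.firstCoord_prolongation hΩ hX hj]
  simp only [totalVec, dirDeriv_add_vec, hC.vert _ hj, add_zero, firstCoord]

/-- The coordinate expression of `∇² u^a`. -/
def lapValue (a : Fin 2) (j : JetSpace) : ℝ :=
  j.2 a (unitIndex 0 + unitIndex 0) + j.2 a (unitIndex 1 + unitIndex 1)

/-- The planar Laplacian is conformally covariant: the horizontal components contribute only the
weight 2ξ_x, its derivative and a transport term. Individual second derivatives of u and v survive
only next to derivatives of φ_u, φ_v, ψ_u, ψ_v. -/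
theorem IsConformal.lapCoord_prolongation (hΩ : IsOpen Ω) (hX : ContDiffOn ℝ ∞ X Ω)
    (hC : IsConformal Ω X) (hj : basePoint j ∈ Ω) (a : Fin 2) (i : Fin 3) :
    lapCoord a i (prolongation X j)
      = dirDeriv (totalVec 0 j) (dirDeriv (totalVec 0 j) (dirDeriv (totalVec i j) (vertComp X a)))
          (basePoint j)
        + dirDeriv (totalVec 1 j) (dirDeriv (totalVec 1 j) (dirDeriv (totalVec i j) (vertComp X a)))
          (basePoint j)
        + (lapValue 0 j * dirDeriv (totalVec i j) (dU (vertComp X a)) (basePoint j)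
          + lapValue 1 j * dirDeriv (totalVec i j) (dV (vertComp X a)) (basePoint j))
        + 2 * (j.2 0 (unitIndex i + unitIndex 0)
            * dirDeriv (totalVec 0 j) (dU (vertComp X a)) (basePoint j)
          + j.2 1 (unitIndex i + unitIndex 0)
            * dirDeriv (totalVec 0 j) (dV (vertComp X a)) (basePoint j)
          + j.2 0 (unitIndex i + unitIndex 1)
            * dirDeriv (totalVec 1 j) (dU (vertComp X a)) (basePoint j)
          + j.2 1 (unitIndex i + unitIndex 1)
            * dirDeriv (totalVec 1 j) (dV (vertComp X a)) (basePoint j))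
        + (lapCoord 0 i j * dU (vertComp X a) (basePoint j)
          + lapCoord 1 i j * dV (vertComp X a) (basePoint j))
        - 2 * dirDeriv (hor i) (dirDeriv (hor 0) (horComp X 0)) (basePoint j) * lapValue a j
        - 2 * dirDeriv (hor 0) (horComp X 0) (basePoint j) * lapCoord a i j
        - (dirDeriv (hor i) (horComp X 0) (basePoint j) * lapCoord a 0 j
          + dirDeriv (hor i) (horComp X 1) (basePoint j) * lapCoord a 1 j
          + dirDeriv (hor i) (horComp X 2) (basePoint j) * lapCoord a 2 j) := by
  have hξ := contDiffOn_horComp hX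
  have n0 : (0 : Fin 3) ≠ 2 := by decide
  have n1 : (1 : Fin 3) ≠ 2 := by decide
  have hh : ∀ m, dirDeriv (hor 0) (dirDeriv (hor 0) (dirDeriv (hor i) (horComp X m))) (basePoint j)
      + dirDeriv (hor 1) (dirDeriv (hor 1) (dirDeriv (hor i) (horComp X m))) (basePoint j) = 0 := by
    intro m
    rw [dirDeriv_rotate hΩ (hξ m) hj, dirDeriv_rotate hΩ (hξ m) hj,
      ← dirDeriv_add hΩ (((hξ m).dirDeriv hΩ _).dirDeriv hΩ _)
        (((hξ m).dirDeriv hΩ _).dirDeriv hΩ _) hj]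
    exact dirDeriv_eq_zero_of_eqOn hΩ (fun q hq => hC.harmonic hΩ hX hq m) _ hj
  -- The Cauchy–Riemann equations and the vanishing of τ_x, τ_y, differentiated along the `i`-th
  -- variable.
  have d1 : dirDeriv (hor 1) (dirDeriv (hor i) (horComp X 1)) (basePoint j)
      = dirDeriv (hor i) (dirDeriv (hor 0) (horComp X 0)) (basePoint j) := by
    rw [dirDeriv_comm hΩ (hξ 1) hj]
    exact dirDeriv_congr hΩ hC.diag _ hj
  have d0 := dirDeriv_comm hΩ (hξ 0) hj (hor 0) (hor i)
  have d2 : dirDeriv (hor 0) (dirDeriv (hor i) (horComp X 1)) (basePoint j)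
      + dirDeriv (hor 1) (dirDeriv (hor i) (horComp X 0)) (basePoint j) = 0 := by
    rw [dirDeriv_comm hΩ (hξ 1) hj, dirDeriv_comm hΩ (hξ 0) hj, ← dirDeriv_add hΩ
      ((hξ 1).dirDeriv hΩ _) ((hξ 0).dirDeriv hΩ _) hj]
    exact dirDeriv_eq_zero_of_eqOn hΩ (c := 0) (fun q hq => by rw [hC.skew q hq]; ring) _ hj
  have d3 : dirDeriv (hor 0) (dirDeriv (hor i) (horComp X 2)) (basePoint j) = 0 := by
    rw [dirDeriv_comm hΩ (hξ 2) hj]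
    exact dirDeriv_eq_zero_of_eqOn hΩ hC.time_x _ hj
  have d4 : dirDeriv (hor 1) (dirDeriv (hor i) (horComp X 2)) (basePoint j) = 0 := by
    rw [dirDeriv_comm hΩ (hξ 2) hj]
    exact dirDeriv_eq_zero_of_eqOn hΩ hC.time_y _ hj
  have l0 := hC.harmonic hΩ hX hj 0
  have l1 := hC.harmonic hΩ hX hj 1
  have l2 := hC.harmonic hΩ hX hj 2
  have h0 := hh 0
  have h1 := hh 1
  have h2 := hh 2
  have c0 := hC.diag _ hj
  have c1 := hC.skew _ hj
  have c2 := hC.time_x _ hj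
  have c3 := hC.time_y _ hj
  rw [lapCoord, prolongation_third hΩ hX hj _ n0, prolongation_third hΩ hX hj _ n1,
    totalDeriv_totalDeriv_totalDeriv_comp_expand hΩ (contDiffOn_vertComp hX a) hj,
    totalDeriv_totalDeriv_totalDeriv_comp_expand hΩ (contDiffOn_vertComp hX a) hj]
  simp only [Fin.sum_univ_three,
    totalDeriv_totalDeriv_totalDeriv_comp_of_vert hΩ (hξ _) (fun p hp => hC.vert p hp _) hj,
    totalDeriv_totalDeriv_comp_of_vert hΩ (hξ _) (fun p hp => hC.vert p hp _) hj]
  have tv : ∀ k m, dirDeriv (totalVec k j) (horComp X m) (basePoint j)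
      = dirDeriv (hor k) (horComp X m) (basePoint j) := fun k m => by
    rw [totalVec, dirDeriv_add_vec, hC.vert _ hj, add_zero]
  have e1 : ∀ k, unitIndex i + unitIndex k + unitIndex k
      = unitIndex k + unitIndex k + unitIndex i := fun k => by abel
  have e2 : unitIndex 1 + unitIndex 0 + unitIndex i
      = unitIndex 0 + unitIndex 1 + unitIndex i := by abel
  have e3 : unitIndex 1 + unitIndex 0 + unitIndex 0
      = unitIndex 0 + unitIndex 0 + unitIndex 1 := by abel
  have e4 : unitIndex 0 + unitIndex 1 + unitIndex 1
      = unitIndex 1 + unitIndex 1 + unitIndex 0 := by abel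
  have e5 : ∀ k, unitIndex 2 + unitIndex k + unitIndex k
      = unitIndex k + unitIndex k + unitIndex 2 := fun k => by abel
  simp only [tv, lapCoord, lapValue, c0, c1, c2, c3, d3, d4, d0, d1, e1, e2, e3, e4, e5]
  simp only [add_comm (unitIndex i), add_comm (unitIndex 1) (unitIndex 0)]
  -- What remains are the Laplacians of ξ, η, τ and of their `i`-th derivatives, and the `i`-th
  -- derivative of η_x + ξ_y as the coefficient of u^a_xy; all of them vanish.
  linear_combination -(h0 * j.2 a (unitIndex 0) + h1 * j.2 a (unitIndex 1)
    + h2 * j.2 a (unitIndex 2)) - (l0 * j.2 a (unitIndex 0 + unitIndex i)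
    + l1 * j.2 a (unitIndex 1 + unitIndex i) + l2 * j.2 a (unitIndex 2 + unitIndex i))
    - 2 * d2 * j.2 a (unitIndex 0 + unitIndex 1)

end Conformal

/-! ### The vertical components: affine dependence on (u, v). -/

section Affine

variable {Ω : Set PhaseSpace} {μ : ℝ} {f : PhaseSpace → ℝ} {X : PhaseSpace → PhaseSpace}
  {j : JetSpace} {p : PhaseSpace}

/-- The condition that the vertical components are affine functions of `(u, v)` whose linear
coefficients depend on time only. -/
structure IsVertAffine (Ω : Set PhaseSpace) (X : PhaseSpace → PhaseSpace) : Prop where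
  hor_vert : ∀ p ∈ Ω, ∀ a w i, i ≠ 2 →
    dirDeriv (hor i) (dirDeriv (vert w) (vertComp X a)) p = 0
  vert_vert : ∀ p ∈ Ω, ∀ a w w', dirDeriv (vert w') (dirDeriv (vert w) (vertComp X a)) p = 0

/-- The vectors `δ`, `ε` are the free mixed derivatives u^a_xt, u^a_yt. At the test jets they enter
only through the coefficient of D_t∇²u^a, so their contribution must vanish by itself. -/
theorem IsWeakSymmetry.second_order_coefficients (hΩ : IsOpen Ω) (hX : ContDiffOn ℝ ∞ X Ω)
    (H : IsWeakSymmetry Ω μ X) (hp : p ∈ Ω) (a : Fin 2) (w₀ w₁ δ ε : Fin 2 → ℝ) :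
    dirDeriv (hor 0 + vert w₀) (dirDeriv (vert δ) (vertComp X a)) p
      + dirDeriv (hor 1 + vert w₁) (dirDeriv (vert ε) (vertComp X a)) p = 0 := by
  have hC := H.isConformal hΩ hX
  have h1 := H.at_harmonicJet hp w₀ w₁ δ ε 0
  have h0 := H.at_harmonicJet hp w₀ w₁ 0 0 0
  have hs : ∀ δ ε, basePoint (harmonicJet p w₀ w₁ δ ε 0) ∈ Ω :=
    fun δ ε => by rwa [basePoint_harmonicJet]
  have z : ∀ δ ε b, lapValue b (harmonicJet p w₀ w₁ δ ε 0) = 0 := fun δ ε b => by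
    fin_cases b <;> simp [lapValue, harmonicJet_coord, unitIndex, harmonicCoord]
  have z' : ∀ δ ε, firstCoord 1 2 (harmonicJet p w₀ w₁ δ ε 0) = 0 := fun δ ε => rfl
  simp only [hC.lapCoord_prolongation hΩ hX (hs _ _), hC.firstCoord_prolongation hΩ hX (hs _ _),
    basePoint_harmonicJet, totalVec_zero_harmonicJet, totalVec_one_harmonicJet,
    totalVec_two_harmonicJet, harmonicJet_coord, lapCoord_harmonicJet, firstCoord_zero_harmonicJet,
    firstCoord_one_harmonicJet, firstCoord_two_harmonicJet, z, z'] at h1 h0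
  rw [dirDeriv_dirDeriv_vert hΩ (contDiffOn_vertComp hX a) hp _ δ,
    dirDeriv_dirDeriv_vert hΩ (contDiffOn_vertComp hX a) hp _ ε]
  simp [unitIndex, harmonicCoord, -dirDeriv_add_vec] at h1 h0
  -- D_t∇²u occurs in the first equation and D_t∇²v in the vorticity equation, with opposite signs;
  -- the term with `μ` does not involve `δ` or `ε` and cancels in the difference.
  fin_cases a
  · simp only [Fin.zero_eta]
    linear_combination (h0.2 - h1.2) / 2
  · simp only [Fin.mk_one]
    linear_combination (h1.1 - h0.1) / 2

theorem IsWeakSymmetry.isVertAffine (hΩ : IsOpen Ω) (hX : ContDiffOn ℝ ∞ X Ω)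
    (H : IsWeakSymmetry Ω μ X) : IsVertAffine Ω X := by
  have h := fun p hp a => H.second_order_coefficients hΩ hX (p := p) hp a
  have h0 : ∀ p ∈ Ω, ∀ a w₀ δ, dirDeriv (hor 0 + vert w₀)
      (dirDeriv (vert δ) (vertComp X a)) p = 0 := fun p hp a w₀ δ => by
    have := h p hp a w₀ 0 δ 0
    rwa [dirDeriv_comm hΩ (contDiffOn_vertComp hX a) hp (hor 1 + _), vert_zero, dirDeriv_zero_vec,
      add_zero] at this
  have h1 : ∀ p ∈ Ω, ∀ a δ, dirDeriv (hor 1) (dirDeriv (vert δ) (vertComp X a)) p = 0 :=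
    fun p hp a δ => by
    have := h p hp a 0 0 0 δ
    rwa [dirDeriv_comm hΩ (contDiffOn_vertComp hX a) hp (hor 0 + _), vert_zero, dirDeriv_zero_vec,
      zero_add, add_zero] at this
  have h2 : ∀ p ∈ Ω, ∀ a δ, dirDeriv (hor 0) (dirDeriv (vert δ) (vertComp X a)) p = 0 :=
    fun p hp a δ => by simpa using h0 p hp a 0 δ
  refine ⟨fun p hp a w i hi => ?_, fun p hp a w w' => ?_⟩
  · fin_cases i
    · exact h2 p hp a w
    · exact h1 p hp a w
    · exact absurd rfl hi
  · have := h0 p hp a w' w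
    rwa [dirDeriv_add_vec, h2 p hp, zero_add] at this

theorem totalVec_eq (i : Fin 3) (j : JetSpace) :
    totalVec i j = hor i + vert fun a => firstCoord a i j := rfl

theorem IsConformal.firstCoord_prolongation_expand (hΩ : IsOpen Ω) (hX : ContDiffOn ℝ ∞ X Ω)
    (hC : IsConformal Ω X) (hj : basePoint j ∈ Ω) (a : Fin 2) (i : Fin 3) :
    firstCoord a i (prolongation X j) = dirDeriv (hor i) (vertComp X a) (basePoint j)
      + (firstCoord 0 i j * dU (vertComp X a) (basePoint j)
        + firstCoord 1 i j * dV (vertComp X a) (basePoint j))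
      - (dirDeriv (hor i) (horComp X 0) (basePoint j) * firstCoord a 0 j
        + dirDeriv (hor i) (horComp X 1) (basePoint j) * firstCoord a 1 j
        + dirDeriv (hor i) (horComp X 2) (basePoint j) * firstCoord a 2 j) := by
  rw [hC.firstCoord_prolongation hΩ hX hj, totalVec_eq, dirDeriv_add_vec, dirDeriv_vert]

/-- Once the two spatial derivatives are moved innermost, affinity removes their vertical parts, and
∂_k² of the component has no vertical derivative left. -/
theorem IsVertAffine.third_derivative (hΩ : IsOpen Ω) (hX : ContDiffOn ℝ ∞ X Ω)
    (hA : IsVertAffine Ω X) (hp : p ∈ Ω) (a : Fin 2) {k : Fin 3} (hk : k ≠ 2) (i : Fin 3)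
    (w w' : Fin 2 → ℝ) :
    dirDeriv (hor k + vert w) (dirDeriv (hor k + vert w) (dirDeriv (hor i + vert w')
      (vertComp X a))) p
      = dirDeriv (hor i) (dirDeriv (hor k) (dirDeriv (hor k) (vertComp X a))) p := by
  have hφ := contDiffOn_vertComp hX a
  have h2 : ∀ q ∈ Ω, dirDeriv (hor k + vert w) (dirDeriv (hor k + vert w) (vertComp X a)) q
      = dirDeriv (hor k) (dirDeriv (hor k) (vertComp X a)) q := fun q hq => by
    rw [dirDeriv_dirDeriv_add_vec hΩ hφ hq, dirDeriv_add_vec, dirDeriv_add_vec,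
      hA.hor_vert q hq _ _ _ hk, hA.vert_vert q hq, dirDeriv_comm hΩ hφ hq (vert w),
      hA.hor_vert q hq _ _ _ hk]
    ring
  rw [dirDeriv_rotate hΩ hφ hp, dirDeriv_congr hΩ h2 _ hp, dirDeriv_add_vec,
    dirDeriv_comm hΩ (hφ.dirDeriv hΩ _) hp (vert w'),
    dirDeriv_eq_zero_of_eqOn (f := dirDeriv (vert w') (dirDeriv (hor k) (vertComp X a))) hΩ
      (c := 0) (fun q hq => ?_) _ hp, add_zero]
  rw [dirDeriv_comm hΩ hφ hq, hA.hor_vert q hq _ _ _ hk]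

theorem IsVertAffine.lapCoord_prolongation (hΩ : IsOpen Ω) (hX : ContDiffOn ℝ ∞ X Ω)
    (hC : IsConformal Ω X) (hA : IsVertAffine Ω X) (hj : basePoint j ∈ Ω) (a : Fin 2)
    (i : Fin 3) :
    lapCoord a i (prolongation X j)
      = dirDeriv (hor i) (dirDeriv (hor 0) (dirDeriv (hor 0) (vertComp X a))) (basePoint j)
        + dirDeriv (hor i) (dirDeriv (hor 1) (dirDeriv (hor 1) (vertComp X a))) (basePoint j)
        + (lapValue 0 j * dirDeriv (hor i) (dU (vertComp X a)) (basePoint j)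
          + lapValue 1 j * dirDeriv (hor i) (dV (vertComp X a)) (basePoint j))
        + (lapCoord 0 i j * dU (vertComp X a) (basePoint j)
          + lapCoord 1 i j * dV (vertComp X a) (basePoint j))
        - 2 * dirDeriv (hor i) (dirDeriv (hor 0) (horComp X 0)) (basePoint j) * lapValue a j
        - 2 * dirDeriv (hor 0) (horComp X 0) (basePoint j) * lapCoord a i j
        - (dirDeriv (hor i) (horComp X 0) (basePoint j) * lapCoord a 0 j
          + dirDeriv (hor i) (horComp X 1) (basePoint j) * lapCoord a 1 j
          + dirDeriv (hor i) (horComp X 2) (basePoint j) * lapCoord a 2 j) := by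
  have n0 : (0 : Fin 3) ≠ 2 := by decide
  have n1 : (1 : Fin 3) ≠ 2 := by decide
  rw [hC.lapCoord_prolongation hΩ hX hj]
  simp only [totalVec_eq, hA.third_derivative hΩ hX hj a n0, hA.third_derivative hΩ hX hj a n1]
  simp only [dirDeriv_add_vec, hA.hor_vert _ hj _ _ _ n0, hA.hor_vert _ hj _ _ _ n1,
    hA.vert_vert _ hj]
  ring

/-- Derivative coordinates with prescribed first-order derivatives `f` and `g` of `u^a` and
`∇² u^a`, and prescribed values `h` of `∇² u^a`. -/
def generalCoord (p : PhaseSpace) (f g : Fin 2 → Fin 3 → ℝ) (h : Fin 2 → ℝ) :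
    Fin 2 → ℕ → ℕ → ℕ → ℝ
  | a, 0, 0, 0 => p.2 a
  | a, 1, 0, 0 => f a 0
  | a, 0, 1, 0 => f a 1
  | a, 0, 0, 1 => f a 2
  | a, 2, 0, 0 => h a
  | a, 3, 0, 0 => g a 0
  | a, 0, 3, 0 => g a 1
  | a, 2, 0, 1 => g a 2
  | _, _, _, _ => 0

/-- Pure x- and y-derivatives and u^a_xxt carry the prescribed values, the other coordinates of
order two and three being zero; so first derivatives, ∇²u^a and D_i∇²u^a are independent. -/
theorem exists_jet (p : PhaseSpace) (f g : Fin 2 → Fin 3 → ℝ) (h : Fin 2 → ℝ) :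
    ∃ j, basePoint j = p ∧ (∀ a i, firstCoord a i j = f a i) ∧ (∀ a i, lapCoord a i j = g a i)
      ∧ ∀ a, lapValue a j = h a := by
  refine ⟨(p.1, fun a J => generalCoord p f g h a (J 0) (J 1) (J 2)), ?_, ?_, ?_, ?_⟩
  · refine Prod.ext rfl (funext fun a => ?_)
    fin_cases a <;> rfl
  · intro a i
    fin_cases a <;> fin_cases i <;> rfl
  · intro a i
    fin_cases a <;> fin_cases i <;> simp [lapCoord, unitIndex, generalCoord]
  · intro a
    fin_cases a <;> simp [lapValue, unitIndex, generalCoord]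

end Affine

/-! ### The determining equations and the action of their solutions on the equations. -/

section Determining

variable {Ω : Set PhaseSpace} {μ : ℝ} {X : PhaseSpace → PhaseSpace} {j : JetSpace}
  {p : PhaseSpace}

/-- The first-order coefficients of the prolongation at `p`, in terms of the first-order
derivatives `f` of `u^a`. -/
noncomputable def firstCoeff (X : PhaseSpace → PhaseSpace) (p : PhaseSpace)
    (f : Fin 2 → Fin 3 → ℝ) (a : Fin 2) (i : Fin 3) : ℝ :=
  dirDeriv (hor i) (vertComp X a) p
    + (f 0 i * dU (vertComp X a) p + f 1 i * dV (vertComp X a) p)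
    - (dirDeriv (hor i) (horComp X 0) p * f a 0 + dirDeriv (hor i) (horComp X 1) p * f a 1
      + dirDeriv (hor i) (horComp X 2) p * f a 2)

/-- The coefficients of the prolongation at `p` for `D_i ∇² u^a`, in terms of the derivatives `g`
and the values `h` of `∇² u^a`. -/
noncomputable def lapCoeff (X : PhaseSpace → PhaseSpace) (p : PhaseSpace)
    (g : Fin 2 → Fin 3 → ℝ) (h : Fin 2 → ℝ) (a : Fin 2) (i : Fin 3) : ℝ :=
  dirDeriv (hor i) (dirDeriv (hor 0) (dirDeriv (hor 0) (vertComp X a))) p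
    + dirDeriv (hor i) (dirDeriv (hor 1) (dirDeriv (hor 1) (vertComp X a))) p
    + (h 0 * dirDeriv (hor i) (dU (vertComp X a)) p + h 1 * dirDeriv (hor i) (dV (vertComp X a)) p)
    + (g 0 i * dU (vertComp X a) p + g 1 i * dV (vertComp X a) p)
    - 2 * dirDeriv (hor i) (dirDeriv (hor 0) (horComp X 0)) p * h a
    - 2 * dirDeriv (hor 0) (horComp X 0) p * g a i
    - (dirDeriv (hor i) (horComp X 0) p * g a 0 + dirDeriv (hor i) (horComp X 1) p * g a 1
      + dirDeriv (hor i) (horComp X 2) p * g a 2)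

/-- The symmetry condition becomes an algebraic identity in the free parameters `f`, `g`, `h`,
subject to the four equations. -/
theorem IsWeakSymmetry.at_jet (hΩ : IsOpen Ω) (hX : ContDiffOn ℝ ∞ X Ω)
    (H : IsWeakSymmetry Ω μ X) (hp : p ∈ Ω) (f g : Fin 2 → Fin 3 → ℝ) (h : Fin 2 → ℝ)
    (hT : f 0 2 - g 0 2 - ((f 0 0 - g 0 0) * f 1 1 - f 1 0 * (f 0 1 - g 0 1)) = 0)
    (hV : g 1 2 - (f 0 0 * g 0 1 - g 0 0 * f 0 1) + (f 1 0 * g 1 1 - g 1 0 * f 1 1) = 0)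
    (hUV : f 0 0 * g 1 1 - g 1 0 * f 0 1 = 0) (hUU : f 0 0 * g 0 1 - g 0 0 * f 0 1 = 0) :
    lapCoeff X p g h 1 2
      - (firstCoeff X p f 0 0 * g 0 1 + f 0 0 * lapCoeff X p g h 0 1
        - (lapCoeff X p g h 0 0 * f 0 1 + g 0 0 * firstCoeff X p f 0 1))
      + (firstCoeff X p f 1 0 * g 1 1 + f 1 0 * lapCoeff X p g h 1 1
        - (lapCoeff X p g h 1 0 * f 1 1 + g 1 0 * firstCoeff X p f 1 1)) = 0 ∧
    firstCoeff X p f 0 2 - lapCoeff X p g h 0 2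
      - ((firstCoeff X p f 0 0 - lapCoeff X p g h 0 0) * f 1 1
          + (f 0 0 - g 0 0) * firstCoeff X p f 1 1
        - (firstCoeff X p f 1 0 * (f 0 1 - g 0 1)
          + f 1 0 * (firstCoeff X p f 0 1 - lapCoeff X p g h 0 1)))
      + μ * (firstCoeff X p f 0 0 * g 1 1 + f 0 0 * lapCoeff X p g h 1 1
        - (lapCoeff X p g h 1 0 * f 0 1 + g 1 0 * firstCoeff X p f 0 1)) = 0 := by
  obtain ⟨j, rfl, h1, h2, h3⟩ := exists_jet p f g h
  have hC := H.isConformal hΩ hX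
  have hA := H.isVertAffine hΩ hX
  have key := H j hp (by rw [truncatedMagneticEq_eq]; simpa only [h1, h2] using hT)
    (by rw [vorticityEq_eq]; simpa only [h1, h2] using hV)
    (by rw [constraintUV_eq]; simpa only [h1, h2] using hUV)
    (by rw [constraintUU_eq]; simpa only [h1, h2] using hUU)
  rw [hasLineDerivAt_vorticityEq.lineDeriv, hasLineDerivAt_truncatedMagneticEq.lineDeriv,
    hasLineDerivAt_constraintUV.lineDeriv] at key
  simpa only [hC.firstCoord_prolongation_expand hΩ hX hp, hA.lapCoord_prolongation hΩ hX hC hp,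
    h1, h2, h3, firstCoeff, lapCoeff] using key

/-- The determining equations of the symmetries of the truncated system together with the
constraint `{u, ∇² u} = 0`. -/
structure IsDetermined (Ω : Set PhaseSpace) (X : PhaseSpace → PhaseSpace) : Prop where
  conformal : IsConformal Ω X
  affine : IsVertAffine Ω X
  div : ∀ p ∈ Ω, dirDeriv (hor 0) (horComp X 0) p = 0
  u_hor : ∀ p ∈ Ω, ∀ i, dirDeriv (hor i) (vertComp X 0) p = 0
  u_v : ∀ p ∈ Ω, dV (vertComp X 0) p = 0
  v_u : ∀ p ∈ Ω, dU (vertComp X 1) p = 0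
  v_v : ∀ p ∈ Ω, dV (vertComp X 1) p = -dirDeriv (hor 2) (horComp X 2) p
  v_x : ∀ p ∈ Ω, dirDeriv (hor 0) (vertComp X 1) p = dirDeriv (hor 2) (horComp X 1) p
  v_y : ∀ p ∈ Ω, dirDeriv (hor 1) (vertComp X 1) p = -dirDeriv (hor 2) (horComp X 0) p
  v_v_time : ∀ p ∈ Ω, dirDeriv (hor 2) (dV (vertComp X 1)) p = 0
  v_lap : ∀ p ∈ Ω, ∀ i, dirDeriv (hor i) (dirDeriv (hor 0) (dirDeriv (hor 0) (vertComp X 1))) p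
    + dirDeriv (hor i) (dirDeriv (hor 1) (dirDeriv (hor 1) (vertComp X 1))) p = 0

/-- Evaluation at sparse jets, each isolating one unknown given the earlier ones. The first equation
is used only at `J1` and `J4`, where u_x, u_y and the spatial derivatives of ∇²v vanish, so its `μ`
term drops out and the outcome does not depend on `μ`. -/
theorem IsWeakSymmetry.isDetermined (hΩ : IsOpen Ω) (hX : ContDiffOn ℝ ∞ X Ω)
    (H : IsWeakSymmetry Ω μ X) : IsDetermined Ω X := by
  have hC := H.isConformal hΩ hX
  have hA := H.isVertAffine hΩ hX
  have hξ := contDiffOn_horComp hX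
  have hφ := contDiffOn_vertComp hX
  have n0 : (0 : Fin 3) ≠ 2 := by decide
  have n1 : (1 : Fin 3) ≠ 2 := by decide
  have au : ∀ p ∈ Ω, ∀ a w, dirDeriv (hor 0) (dirDeriv (vert w) (vertComp X a)) p = 0 :=
    fun p hp a w => hA.hor_vert p hp a w 0 n0
  have av : ∀ p ∈ Ω, ∀ a w, dirDeriv (hor 1) (dirDeriv (vert w) (vertComp X a)) p = 0 :=
    fun p hp a w => hA.hor_vert p hp a w 1 n1
  have J1 := fun p (hp : p ∈ Ω) h =>
    H.at_jet hΩ hX hp 0 0 h (by simp) (by simp) (by simp) (by simp)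
  have J2 := fun p (hp : p ∈ Ω) h =>
    (H.at_jet hΩ hX hp ![0, ![1, 0, 0]] 0 h (by simp) (by simp) (by simp) (by simp)).1
  have J3 := fun p (hp : p ∈ Ω) h =>
    (H.at_jet hΩ hX hp ![0, ![0, 1, 0]] 0 h (by simp) (by simp) (by simp) (by simp)).1
  -- u_t = D_t∇²u = 1 solves the first equation. The common weight φ_u - τ_t cancels, which leaves
  -- the extra weight 2ξ_x of the Laplacian; the vorticity equation gives ψ_u = 0.
  have J4 := fun p (hp : p ∈ Ω) =>
    H.at_jet hΩ hX hp ![![0, 0, 1], 0] ![![0, 0, 1], 0] 0 (by simp) (by simp) (by simp) (by simp)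
  have J5 := fun p (hp : p ∈ Ω) =>
    (H.at_jet hΩ hX hp 0 ![0, ![1, 0, 0]] 0 (by simp) (by simp) (by simp) (by simp)).1
  have J6 := fun p (hp : p ∈ Ω) =>
    (H.at_jet hΩ hX hp 0 ![0, ![0, 1, 0]] 0 (by simp) (by simp) (by simp) (by simp)).1
  have J7 := fun p (hp : p ∈ Ω) =>
    (H.at_jet hΩ hX hp 0 ![![1, 0, 0], 0] 0 (by simp) (by simp) (by simp) (by simp)).1
  have J8 := fun p (hp : p ∈ Ω) =>
    (H.at_jet hΩ hX hp 0 ![![0, 1, 0], 0] 0 (by simp) (by simp) (by simp) (by simp)).1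
  -- v_x = D_y∇²u = 1 isolates φ_v; u_t = 1 is the value that the first equation requires.
  have J9 := fun p (hp : p ∈ Ω) =>
    (H.at_jet hΩ hX hp ![![0, 0, 1], ![1, 0, 0]] ![![0, 1, 0], 0] 0
      (by simp) (by simp) (by simp) (by simp)).1
  -- v_x = D_y∇²v = 1 and D_t∇²v = -1 balance the time derivative against {v,∇²v}, which relates the
  -- scaling of v to that of time.
  have J10 := fun p (hp : p ∈ Ω) =>
    (H.at_jet hΩ hX hp ![0, ![1, 0, 0]] ![0, ![0, 1, -1]] 0
      (by simp) (by simp) (by simp) (by simp)).1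
  have l2 : ∀ p ∈ Ω, dirDeriv (hor 2) (dirDeriv (hor 0) (dirDeriv (hor 0) (vertComp X 1))) p
      + dirDeriv (hor 2) (dirDeriv (hor 1) (dirDeriv (hor 1) (vertComp X 1))) p = 0 :=
    fun p hp => by
    have := (J1 p hp 0).1
    simpa [firstCoeff, lapCoeff] using this
  have e2 : ∀ p ∈ Ω, dirDeriv (hor 2) (dV (vertComp X 1)) p
      = 2 * dirDeriv (hor 2) (dirDeriv (hor 0) (horComp X 0)) p := fun p hp => by
    have := (J1 p hp ![0, 1]).1
    simp [firstCoeff, lapCoeff, l2 p hp] at this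
    linarith
  have f2 : ∀ p ∈ Ω, dirDeriv (hor 2) (vertComp X 0) p
      = dirDeriv (hor 2) (dirDeriv (hor 0) (dirDeriv (hor 0) (vertComp X 0))) p
      + dirDeriv (hor 2) (dirDeriv (hor 1) (dirDeriv (hor 1) (vertComp X 0))) p := fun p hp => by
    have := (J1 p hp 0).2
    simp [firstCoeff, lapCoeff] at this
    linarith
  have l1 : ∀ p ∈ Ω, dirDeriv (hor 1) (dirDeriv (hor 0) (dirDeriv (hor 0) (vertComp X 1))) p
      + dirDeriv (hor 1) (dirDeriv (hor 1) (dirDeriv (hor 1) (vertComp X 1))) p = 0 :=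
    fun p hp => by
    have := J2 p hp 0
    simpa [firstCoeff, lapCoeff, l2 p hp] using this
  have l0 : ∀ p ∈ Ω, dirDeriv (hor 0) (dirDeriv (hor 0) (dirDeriv (hor 0) (vertComp X 1))) p
      + dirDeriv (hor 0) (dirDeriv (hor 1) (dirDeriv (hor 1) (vertComp X 1))) p = 0 :=
    fun p hp => by
    have := J3 p hp 0
    simp [firstCoeff, lapCoeff, l2 p hp] at this
    linarith
  have c : ∀ p ∈ Ω, dU (vertComp X 1) p = 0 := fun p hp => by
    have := (J4 p hp).1
    simpa [firstCoeff, lapCoeff, l2 p hp] using this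
  have d : ∀ p ∈ Ω, dirDeriv (hor 0) (horComp X 0) p = 0 := fun p hp => by
    have := (J4 p hp).2
    simp [firstCoeff, lapCoeff] at this
    linarith [f2 p hp]
  have vy : ∀ p ∈ Ω, dirDeriv (hor 1) (vertComp X 1) p = -dirDeriv (hor 2) (horComp X 0) p :=
    fun p hp => by
    have := J5 p hp
    simp [firstCoeff, lapCoeff, l2 p hp] at this
    linarith
  have vx : ∀ p ∈ Ω, dirDeriv (hor 0) (vertComp X 1) p = dirDeriv (hor 2) (horComp X 1) p :=
    fun p hp => by
    have := J6 p hp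
    simp [firstCoeff, lapCoeff, l2 p hp] at this
    linarith
  have uy : ∀ p ∈ Ω, dirDeriv (hor 1) (vertComp X 0) p = 0 := fun p hp => by
    have := J7 p hp
    simpa [firstCoeff, lapCoeff, l2 p hp, c p hp] using this
  have ux : ∀ p ∈ Ω, dirDeriv (hor 0) (vertComp X 0) p = 0 := fun p hp => by
    have := J8 p hp
    simpa [firstCoeff, lapCoeff, l2 p hp, c p hp] using this
  have b : ∀ p ∈ Ω, dV (vertComp X 0) p = 0 := fun p hp => by
    have := J9 p hp
    simpa [firstCoeff, lapCoeff, l2 p hp, l1 p hp, c p hp, ux p hp, hC.time_x p hp] using this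
  have e : ∀ p ∈ Ω, dV (vertComp X 1) p = -dirDeriv (hor 2) (horComp X 2) p := fun p hp => by
    have := J10 p hp
    simp [firstCoeff, lapCoeff, l2 p hp, l1 p hp, d p hp, vx p hp, hC.diag p hp, hC.time_y p hp]
      at this
    linarith
  -- `f2` says φ_t = ∂_t(φ_xx + φ_yy), and φ_x = φ_y = 0 are already known.
  have ut : ∀ p ∈ Ω, dirDeriv (hor 2) (vertComp X 0) p = 0 := fun p hp => by
    rw [f2 p hp,
      dirDeriv_eq_zero_of_eqOn hΩ (fun q hq => dirDeriv_eq_zero_of_eqOn hΩ ux _ hq) _ hp,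
      dirDeriv_eq_zero_of_eqOn hΩ (fun q hq => dirDeriv_eq_zero_of_eqOn hΩ uy _ hq) _ hp, add_zero]
  refine ⟨hC, hA, d, fun p hp i => ?_, b, c, e, vx, vy, fun p hp => ?_, fun p hp i => ?_⟩
  · fin_cases i
    exacts [ux p hp, uy p hp, ut p hp]
  · rw [e2 p hp, dirDeriv_eq_zero_of_eqOn hΩ d _ hp, mul_zero]
  · fin_cases i
    exacts [l0 p hp, l1 p hp, l2 p hp]

theorem IsDetermined.firstCoord_u (hΩ : IsOpen Ω) (hX : ContDiffOn ℝ ∞ X Ω)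
    (hD : IsDetermined Ω X) (hj : basePoint j ∈ Ω) (i : Fin 3) :
    firstCoord 0 i (prolongation X j) = dU (vertComp X 0) (basePoint j) * firstCoord 0 i j
      - (dirDeriv (hor i) (horComp X 0) (basePoint j) * firstCoord 0 0 j
        + dirDeriv (hor i) (horComp X 1) (basePoint j) * firstCoord 0 1 j
        + dirDeriv (hor i) (horComp X 2) (basePoint j) * firstCoord 0 2 j) := by
  rw [hD.conformal.firstCoord_prolongation_expand hΩ hX hj, hD.u_hor _ hj, hD.u_v _ hj]
  ring

theorem IsDetermined.firstCoord_v (hΩ : IsOpen Ω) (hX : ContDiffOn ℝ ∞ X Ω)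
    (hD : IsDetermined Ω X) (hj : basePoint j ∈ Ω) (i : Fin 3) :
    firstCoord 1 i (prolongation X j) = dirDeriv (hor i) (vertComp X 1) (basePoint j)
      - dirDeriv (hor 2) (horComp X 2) (basePoint j) * firstCoord 1 i j
      - (dirDeriv (hor i) (horComp X 0) (basePoint j) * firstCoord 1 0 j
        + dirDeriv (hor i) (horComp X 1) (basePoint j) * firstCoord 1 1 j
        + dirDeriv (hor i) (horComp X 2) (basePoint j) * firstCoord 1 2 j) := by
  rw [hD.conformal.firstCoord_prolongation_expand hΩ hX hj, hD.v_u _ hj, hD.v_v _ hj]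
  ring

theorem IsDetermined.lapCoord_u (hΩ : IsOpen Ω) (hX : ContDiffOn ℝ ∞ X Ω)
    (hD : IsDetermined Ω X) (hj : basePoint j ∈ Ω) (i : Fin 3) :
    lapCoord 0 i (prolongation X j) = dU (vertComp X 0) (basePoint j) * lapCoord 0 i j
      - (dirDeriv (hor i) (horComp X 0) (basePoint j) * lapCoord 0 0 j
        + dirDeriv (hor i) (horComp X 1) (basePoint j) * lapCoord 0 1 j
        + dirDeriv (hor i) (horComp X 2) (basePoint j) * lapCoord 0 2 j) := by
  have h : ∀ k, dirDeriv (hor i) (dirDeriv (hor k) (dirDeriv (hor k) (vertComp X 0)))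
      (basePoint j) = 0 := fun k =>
    dirDeriv_eq_zero_of_eqOn hΩ
      (fun q hq => dirDeriv_eq_zero_of_eqOn hΩ (fun r hr => hD.u_hor r hr k) _ hq) _ hj
  rw [hD.affine.lapCoord_prolongation hΩ hX hD.conformal hj, hD.u_v _ hj, hD.div _ hj,
    dirDeriv_eq_zero_of_eqOn hΩ hD.div _ hj, dirDeriv_eq_zero_of_eqOn hΩ hD.u_v _ hj, h, h,
    dirDeriv_comm hΩ (contDiffOn_vertComp hX 0) hj,
    dirDeriv_eq_zero_of_eqOn hΩ (fun q hq => hD.u_hor q hq i) _ hj]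
  ring

theorem IsDetermined.lapCoord_v (hΩ : IsOpen Ω) (hX : ContDiffOn ℝ ∞ X Ω)
    (hD : IsDetermined Ω X) (hj : basePoint j ∈ Ω) (i : Fin 3) :
    lapCoord 1 i (prolongation X j)
      = -dirDeriv (hor 2) (horComp X 2) (basePoint j) * lapCoord 1 i j
      - (dirDeriv (hor i) (horComp X 0) (basePoint j) * lapCoord 1 0 j
        + dirDeriv (hor i) (horComp X 1) (basePoint j) * lapCoord 1 1 j
        + dirDeriv (hor i) (horComp X 2) (basePoint j) * lapCoord 1 2 j) := by
  have h : dirDeriv (hor i) (dV (vertComp X 1)) (basePoint j) = 0 := by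
    by_cases hi : i = 2
    · rw [hi, hD.v_v_time _ hj]
    · exact hD.affine.hor_vert _ hj _ _ _ hi
  rw [hD.affine.lapCoord_prolongation hΩ hX hD.conformal hj, hD.v_u _ hj, hD.v_v _ hj,
    hD.div _ hj, dirDeriv_eq_zero_of_eqOn hΩ hD.div _ hj, hD.v_lap _ hj,
    dirDeriv_eq_zero_of_eqOn hΩ hD.v_u _ hj, h]
  ring

/-- D_t∇²v and {v,∇²v} scale with -2τ_t while {u,∇²u} scales with 2φ_u; the mismatch is the last
term. The time dependence of ξ, η is compensated by ψ_x = η_t and ψ_y = -ξ_t. -/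
theorem IsDetermined.lineDeriv_vorticityEq (hΩ : IsOpen Ω) (hX : ContDiffOn ℝ ∞ X Ω)
    (hD : IsDetermined Ω X) (hj : basePoint j ∈ Ω) :
    lineDeriv ℝ vorticityEq j (prolongation X j)
      = -2 * dirDeriv (hor 2) (horComp X 2) (basePoint j) * vorticityEq j
        - 2 * (dU (vertComp X 0) (basePoint j) + dirDeriv (hor 2) (horComp X 2) (basePoint j))
          * constraintUU j := by
  rw [hasLineDerivAt_vorticityEq.lineDeriv, vorticityEq_eq, constraintUU_eq]
  simp only [hD.firstCoord_u hΩ hX hj, hD.firstCoord_v hΩ hX hj, hD.lapCoord_u hΩ hX hj,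
    hD.lapCoord_v hΩ hX hj, hD.div _ hj, hD.v_x _ hj, hD.v_y _ hj, hD.conformal.diag _ hj,
    hD.conformal.skew _ hj, hD.conformal.time_x _ hj, hD.conformal.time_y _ hj]
  ring

theorem IsDetermined.lineDeriv_truncatedMagneticEq (hΩ : IsOpen Ω) (hX : ContDiffOn ℝ ∞ X Ω)
    (hD : IsDetermined Ω X) (hj : basePoint j ∈ Ω) :
    lineDeriv ℝ truncatedMagneticEq j (prolongation X j)
      = (dU (vertComp X 0) (basePoint j) - dirDeriv (hor 2) (horComp X 2) (basePoint j))
        * truncatedMagneticEq j := by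
  rw [hasLineDerivAt_truncatedMagneticEq.lineDeriv, truncatedMagneticEq_eq]
  simp only [hD.firstCoord_u hΩ hX hj, hD.firstCoord_v hΩ hX hj, hD.lapCoord_u hΩ hX hj,
    hD.div _ hj, hD.v_x _ hj, hD.v_y _ hj, hD.conformal.diag _ hj,
    hD.conformal.skew _ hj, hD.conformal.time_x _ hj, hD.conformal.time_y _ hj]
  ring

theorem IsDetermined.lineDeriv_constraintUV (hΩ : IsOpen Ω) (hX : ContDiffOn ℝ ∞ X Ω)
    (hD : IsDetermined Ω X) (hj : basePoint j ∈ Ω) :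
    lineDeriv ℝ constraintUV j (prolongation X j)
      = (dU (vertComp X 0) (basePoint j) - dirDeriv (hor 2) (horComp X 2) (basePoint j))
        * constraintUV j := by
  rw [hasLineDerivAt_constraintUV.lineDeriv, constraintUV_eq]
  simp only [hD.firstCoord_u hΩ hX hj, hD.lapCoord_v hΩ hX hj,
    hD.div _ hj, hD.conformal.diag _ hj,
    hD.conformal.skew _ hj, hD.conformal.time_x _ hj, hD.conformal.time_y _ hj]
  ring

theorem IsDetermined.lineDeriv_constraintUU (hΩ : IsOpen Ω) (hX : ContDiffOn ℝ ∞ X Ω)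
    (hD : IsDetermined Ω X) (hj : basePoint j ∈ Ω) :
    lineDeriv ℝ constraintUU j (prolongation X j)
      = 2 * dU (vertComp X 0) (basePoint j) * constraintUU j := by
  rw [hasLineDerivAt_constraintUU.lineDeriv, constraintUU_eq]
  simp only [hD.firstCoord_u hΩ hX hj, hD.lapCoord_u hΩ hX hj,
    hD.div _ hj, hD.conformal.diag _ hj,
    hD.conformal.skew _ hj, hD.conformal.time_x _ hj, hD.conformal.time_y _ hj]
  ring

theorem IsDetermined.lineDeriv_magneticEq (hΩ : IsOpen Ω) (hX : ContDiffOn ℝ ∞ X Ω)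
    (hD : IsDetermined Ω X) (hj : basePoint j ∈ Ω) :
    lineDeriv ℝ magneticEq j (prolongation X j)
      = (dU (vertComp X 0) (basePoint j) - dirDeriv (hor 2) (horComp X 2) (basePoint j))
        * magneticEq j := by
  rw [_root_.lineDeriv_magneticEq, hD.lineDeriv_truncatedMagneticEq hΩ hX hj,
    hD.lineDeriv_constraintUV hΩ hX hj, magneticEq_eq]
  ring

end Determining

/-! ### Identification of the symmetry sets and the partial symmetry. -/

section Symmetries

variable {Ω : Set PhaseSpace} {S : Set (JetSpace → ℝ)} {X : PhaseSpace → PhaseSpace}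
  {p : PhaseSpace}

/-- The smooth solutions of the determining equations. -/
def determinedFields (Ω : Set PhaseSpace) : Set (PhaseSpace → PhaseSpace) :=
  {X | ContDiffOn ℝ ∞ X Ω ∧ IsDetermined Ω X}

/-- The smooth solutions of the determining equations for which `u` and `v` scale inversely to
time. -/
def inverseScalingFields (Ω : Set PhaseSpace) : Set (PhaseSpace → PhaseSpace) :=
  {X ∈ determinedFields Ω |
    ∀ p ∈ Ω, dU (vertComp X 0) p + dirDeriv (hor 2) (horComp X 2) p = 0}

theorem lieSymmetries_subset_determinedFields (hΩ : IsOpen Ω)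
    (hS : S ⊆ {magneticEq, truncatedMagneticEq, vorticityEq, constraintUV, constraintUU})
    (hV : vorticityEq ∈ S) (hM : magneticEq ∈ S ∨ truncatedMagneticEq ∈ S) :
    lieSymmetries Ω S ⊆ determinedFields Ω := by
  rintro X ⟨hX, H⟩
  refine ⟨hX, ?_⟩
  have hz : ∀ j, truncatedMagneticEq j = 0 → vorticityEq j = 0 → constraintUV j = 0 →
      constraintUU j = 0 → ∀ F ∈ S, F j = 0 := by
    intro j h1 h2 h3 h4 F hF
    rcases hS hF with rfl | rfl | rfl | rfl | rfl
    · rw [magneticEq_eq]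
      simp [h1, h3]
    all_goals assumption
  rcases hM with hM | hM
  · refine IsWeakSymmetry.isDetermined (μ := 1) hΩ hX fun j hj h1 h2 h3 h4 => ?_
    have h := H j hj (hz j h1 h2 h3 h4)
    exact ⟨h _ hV, by rw [one_mul, ← lineDeriv_magneticEq]; exact h _ hM⟩
  · refine IsWeakSymmetry.isDetermined (μ := 0) hΩ hX fun j hj h1 h2 h3 h4 => ?_
    have h := H j hj (hz j h1 h2 h3 h4)
    exact ⟨h _ hV, by rw [zero_mul, add_zero]; exact h _ hM⟩

theorem lieSymmetries_eq_determinedFields (hΩ : IsOpen Ω)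
    (hS : S ⊆ {magneticEq, truncatedMagneticEq, vorticityEq, constraintUV, constraintUU})
    (hV : vorticityEq ∈ S) (hM : magneticEq ∈ S ∨ truncatedMagneticEq ∈ S)
    (hU : constraintUU ∈ S) : lieSymmetries Ω S = determinedFields Ω := by
  refine (lieSymmetries_subset_determinedFields hΩ hS hV hM).antisymm ?_
  rintro X ⟨hX, hD⟩
  refine ⟨hX, fun j hj hz F hF => ?_⟩
  have h0 := hz F hF
  rcases hS hF with rfl | rfl | rfl | rfl | rfl
  · rw [hD.lineDeriv_magneticEq hΩ hX hj, h0, mul_zero]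
  · rw [hD.lineDeriv_truncatedMagneticEq hΩ hX hj, h0, mul_zero]
  · rw [hD.lineDeriv_vorticityEq hΩ hX hj, h0, hz _ hU]
    ring
  · rw [hD.lineDeriv_constraintUV hΩ hX hj, h0, mul_zero]
  · rw [hD.lineDeriv_constraintUU hΩ hX hj, h0, mul_zero]

theorem lieSymmetries_eq_inverseScalingFields (hΩ : IsOpen Ω)
    (hS : S ⊆ {magneticEq, truncatedMagneticEq, vorticityEq, constraintUV})
    (hV : vorticityEq ∈ S) (hM : magneticEq ∈ S ∨ truncatedMagneticEq ∈ S) :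
    lieSymmetries Ω S = inverseScalingFields Ω := by
  apply Set.Subset.antisymm
  · intro X hXS
    obtain ⟨hX, hD⟩ := lieSymmetries_subset_determinedFields hΩ
      (hS.trans fun F hF => by
        simp only [Set.mem_insert_iff, Set.mem_singleton_iff] at hF ⊢
        tauto) hV hM hXS
    refine ⟨⟨hX, hD⟩, fun p hp => ?_⟩
    -- u_x = D_y∇²u = 1 makes {u,∇²u} = 1; D_t∇²v = 1 balances it in the vorticity equation, and u_t
    -- = D_t∇²u = 1 solves the first equation.
    obtain ⟨j, rfl, h1, h2, -⟩ := exists_jet p ![![1, 0, 1], 0] ![![0, 1, 1], ![0, 0, 1]] 0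
    have hUV : constraintUV j = 0 := by simp [constraintUV_eq, h1, h2]
    have hT : truncatedMagneticEq j = 0 := by simp [truncatedMagneticEq_eq, h1, h2]
    have hW : vorticityEq j = 0 := by simp [vorticityEq_eq, h1, h2]
    have hUU : constraintUU j = 1 := by simp [constraintUU_eq, h1, h2]
    have h := hXS.2 j hp (fun F hF => by
      rcases hS hF with rfl | rfl | rfl | rfl
      · rw [magneticEq_eq]
        simp [hT, hUV]
      all_goals assumption) _ hV
    rw [hD.lineDeriv_vorticityEq hΩ hX hp, hW, hUU] at h
    linarith
  · rintro X ⟨⟨hX, hD⟩, hκ⟩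
    refine ⟨hX, fun j hj hz F hF => ?_⟩
    have h0 := hz F hF
    rcases hS hF with rfl | rfl | rfl | rfl
    · rw [hD.lineDeriv_magneticEq hΩ hX hj, h0, mul_zero]
    · rw [hD.lineDeriv_truncatedMagneticEq hΩ hX hj, h0, mul_zero]
    · rw [hD.lineDeriv_vorticityEq hΩ hX hj, h0, hκ _ hj]
      ring
    · rw [hD.lineDeriv_constraintUV hΩ hX hj, h0, mul_zero]

theorem dirDeriv_eq_of_add_const (hΩ : IsOpen Ω) {f g : PhaseSpace → ℝ} {c : ℝ}
    (h : ∀ p ∈ Ω, g p = f p + c) (hp : p ∈ Ω) (v : PhaseSpace) :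
    dirDeriv v g p = dirDeriv v f p := by
  rw [dirDeriv_congr hΩ (g := fun p => f p + c) h v hp]
  simp [dirDeriv]

theorem horComp_add_smul_scalingField (X : PhaseSpace → PhaseSpace) (c : ℝ) (m : Fin 3) :
    horComp (X + c • scalingField) m = horComp X m := by
  funext p
  simp [horComp, scalingField]

theorem vertComp_one_add_smul_scalingField (X : PhaseSpace → PhaseSpace) (c : ℝ) :
    vertComp (X + c • scalingField) 1 = vertComp X 1 := by
  funext p
  simp [vertComp, scalingField]

theorem contDiff_coord (a : Fin 2) : ContDiff ℝ ∞ fun p : PhaseSpace => p.2 a :=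
  (contDiff_apply ℝ ℝ a).comp contDiff_snd

theorem dirDeriv_coord (a : Fin 2) (v : PhaseSpace) :
    dirDeriv v (fun p : PhaseSpace => p.2 a) p = v.2 a :=
  congrArg (· v) ((ContinuousLinearMap.proj (R := ℝ) (φ := fun _ : Fin 2 => ℝ) a).comp
    (ContinuousLinearMap.snd ℝ (Fin 3 → ℝ) (Fin 2 → ℝ))).hasFDerivAt.fderiv

theorem dirDeriv_vertComp_zero_add_smul_scalingField (hΩ : IsOpen Ω) (hX : ContDiffOn ℝ ∞ X Ω)
    (c : ℝ) (hp : p ∈ Ω) (v : PhaseSpace) :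
    dirDeriv v (vertComp (X + c • scalingField) 0) p = dirDeriv v (vertComp X 0) p + c * v.2 0 := by
  have h : vertComp (X + c • scalingField) 0 = fun p => vertComp X 0 p + c * p.2 0 := by
    funext p
    simp [vertComp, scalingField]
  rw [h, dirDeriv_add hΩ (contDiffOn_vertComp hX 0)
    (contDiffOn_const.mul (contDiff_coord 0).contDiffOn) hp,
    dirDeriv_const_mul hΩ (contDiff_coord 0).contDiffOn hp, dirDeriv_coord]

/-- Only φ changes, and its first derivatives only by constants; the equations constrain neither φ_u
itself nor its relation to τ_t. -/
theorem add_smul_scalingField_mem_determinedFields (hΩ : IsOpen Ω)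
    (hX : X ∈ determinedFields Ω) (c : ℝ) : X + c • scalingField ∈ determinedFields Ω := by
  obtain ⟨hX, hD⟩ := hX
  have hS : ContDiff ℝ ∞ scalingField := by
    refine contDiff_const.prodMk (contDiff_pi.2 fun a => ?_)
    fin_cases a
    · exact contDiff_coord 0
    · exact contDiff_const
  have hd := fun p (hp : p ∈ Ω) v => dirDeriv_vertComp_zero_add_smul_scalingField hΩ hX c hp v
  have hdd := fun p (hp : p ∈ Ω) v w =>
    dirDeriv_eq_of_add_const hΩ (fun q hq => hd q hq w) hp v
  refine ⟨hX.add (contDiff_const.smul hS).contDiffOn, ⟨?_, ?_, ?_, ?_, ?_⟩, ⟨?_, ?_⟩, ?_, ?_, ?_, ?_,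
    ?_, ?_, ?_, ?_, ?_⟩
  all_goals
    try simp only [horComp_add_smul_scalingField, vertComp_one_add_smul_scalingField]
  · exact hD.conformal.vert
  · exact hD.conformal.time_x
  · exact hD.conformal.time_y
  · exact hD.conformal.diag
  · exact hD.conformal.skew
  · intro p hp a w i hi
    fin_cases a
    · exact (hdd p hp _ _).trans (hD.affine.hor_vert p hp 0 w i hi)
    · exact (congrArg (fun f => dirDeriv (hor i) (dirDeriv (vert w) f) p)
        (vertComp_one_add_smul_scalingField X c)).trans (hD.affine.hor_vert p hp 1 w i hi)
  · intro p hp a w w'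
    fin_cases a
    · exact (hdd p hp _ _).trans (hD.affine.vert_vert p hp 0 w w')
    · exact (congrArg (fun f => dirDeriv (vert w') (dirDeriv (vert w) f) p)
        (vertComp_one_add_smul_scalingField X c)).trans (hD.affine.vert_vert p hp 1 w w')
  · exact hD.div
  · intro p hp i
    rw [hd p hp, hD.u_hor p hp]
    simp [hor]
  · intro p hp
    have e : (vert ![0, 1]).2 0 = 0 := rfl
    rw [dV, hd p hp, e, mul_zero, add_zero]
    exact hD.u_v p hp
  · exact hD.v_u
  · exact hD.v_v
  · exact hD.v_x
  · exact hD.v_y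
  · exact hD.v_v_time
  · exact hD.v_lap

/-- All derivatives of φ_u + τ_t vanish: φ is affine in u alone with constant slope, τ depends on
time only, and τ_tt = -ψ_vt = 0. -/
theorem IsDetermined.exists_scaling_defect (hΩ : IsOpen Ω) (hc : IsPreconnected Ω)
    (hX : ContDiffOn ℝ ∞ X Ω) (hD : IsDetermined Ω X) :
    ∃ c : ℝ, ∀ p ∈ Ω, dU (vertComp X 0) p + dirDeriv (hor 2) (horComp X 2) p = c := by
  have hφ := contDiffOn_vertComp hX
  have hξ := contDiffOn_horComp hX
  have hs : ContDiffOn ℝ ∞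
      (fun p => dU (vertComp X 0) p + dirDeriv (hor 2) (horComp X 2) p) Ω :=
    ((hφ 0).dirDeriv hΩ _).add ((hξ 2).dirDeriv hΩ _)
  refine hΩ.exists_is_const_of_fderiv_eq_zero (𝕜 := ℝ) hc (hs.differentiableOn (by simp))
    fun p hp => ContinuousLinearMap.ext fun v => ?_
  have hd : ∀ w, dirDeriv w (fun p => dU (vertComp X 0) p + dirDeriv (hor 2) (horComp X 2) p) p
      = dirDeriv w (dU (vertComp X 0)) p + dirDeriv w (dirDeriv (hor 2) (horComp X 2)) p :=
    dirDeriv_add hΩ ((hφ 0).dirDeriv hΩ _) ((hξ 2).dirDeriv hΩ _) hp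
  have hv : ∀ w, dirDeriv (vert w)
      (fun p => dU (vertComp X 0) p + dirDeriv (hor 2) (horComp X 2) p) p = 0 := fun w => by
    rw [hd, hD.affine.vert_vert p hp, dirDeriv_comm hΩ (hξ 2) hp,
      dirDeriv_eq_zero_of_eqOn hΩ (fun q hq => hD.conformal.vert q hq 2 w) _ hp, add_zero]
  have hh : ∀ i, dirDeriv (hor i)
      (fun p => dU (vertComp X 0) p + dirDeriv (hor 2) (horComp X 2) p) p = 0 := fun i => by
    rw [hd, dirDeriv_comm hΩ (hφ 0) hp,
      dirDeriv_eq_zero_of_eqOn hΩ (fun q hq => hD.u_hor q hq i) _ hp, zero_add]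
    fin_cases i
    · exact (dirDeriv_comm hΩ (hξ 2) hp _ _).trans
        (dirDeriv_eq_zero_of_eqOn hΩ hD.conformal.time_x _ hp)
    · exact (dirDeriv_comm hΩ (hξ 2) hp _ _).trans
        (dirDeriv_eq_zero_of_eqOn hΩ hD.conformal.time_y _ hp)
    · have h1 := hD.v_v_time p hp
      rw [dirDeriv_congr hΩ (g := fun q => (-1) * dirDeriv (hor 2) (horComp X 2) q)
        (fun q hq => by rw [hD.v_v q hq]; ring) _ hp,
        dirDeriv_const_mul hΩ ((hξ 2).dirDeriv hΩ _) hp] at h1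
      simp only [Fin.reduceFinMk]
      linarith
  have e : v = v.1 0 • hor 0 + v.1 1 • hor 1 + v.1 2 • hor 2 + vert v.2 := by
    refine Prod.ext (funext fun i => ?_) (by simp [hor, vert])
    fin_cases i <;> simp [hor, vert]
  simp only [dirDeriv] at hh hv
  rw [e]
  simp only [map_add, map_smul]
  simp only [dirDeriv, hh, hv]
  simp

theorem determinedFields_eq (hΩ : IsOpen Ω) (hc : IsPreconnected Ω) :
    determinedFields Ω
      = {X | ∃ Y ∈ inverseScalingFields Ω, ∃ c : ℝ, X = Y + c • scalingField} := by
  ext X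
  constructor
  · intro hX
    obtain ⟨c, h⟩ := hX.2.exists_scaling_defect hΩ hc hX.1
    refine ⟨X + (-c) • scalingField,
      ⟨add_smul_scalingField_mem_determinedFields hΩ hX _, fun p hp => ?_⟩, c, by simp⟩
    rw [dU, dirDeriv_vertComp_zero_add_smul_scalingField hΩ hX.1 _ hp,
      horComp_add_smul_scalingField]
    have e : (vert ![1, 0]).2 0 = 1 := rfl
    rw [e]
    linarith [h p hp]
  · rintro ⟨Y, hY, c, rfl⟩
    exact add_smul_scalingField_mem_determinedFields hΩ hY.1 c

end Symmetries

theorem proposition3 (Ω : Set PhaseSpace) (hΩ : IsOpen Ω) :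
    lieSymmetries Ω truncatedSystem = lieSymmetries Ω originalSystem ∧
    (∀ C : Set (JetSpace → ℝ), C ⊆ {constraintUV, constraintUU} → C.Nonempty →
      lieSymmetries Ω (truncatedSystem ∪ C) = lieSymmetries Ω (originalSystem ∪ C)) ∧
    lieSymmetries Ω (truncatedSystem ∪ {constraintUV}) = lieSymmetries Ω originalSystem ∧
    (IsConnected Ω → ∀ C : Set (JetSpace → ℝ), C ⊆ {constraintUV, constraintUU} →
      constraintUU ∈ C →
      lieSymmetries Ω (truncatedSystem ∪ C) =
        {X | ∃ Y ∈ lieSymmetries Ω originalSystem, ∃ c : ℝ, X = Y + c • scalingField}) := by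
  have hT : ∀ C ⊆ {constraintUV}, lieSymmetries Ω (truncatedSystem ∪ C)
      = inverseScalingFields Ω := fun C hC =>
    lieSymmetries_eq_inverseScalingFields hΩ
      (Set.union_subset (by rintro F (rfl | rfl) <;> simp)
        (hC.trans (by rintro F rfl; simp)))
      (by simp [truncatedSystem]) (by simp [truncatedSystem])
  have hO : ∀ C ⊆ {constraintUV}, lieSymmetries Ω (originalSystem ∪ C)
      = inverseScalingFields Ω := fun C hC =>
    lieSymmetries_eq_inverseScalingFields hΩ
      (Set.union_subset (by rintro F (rfl | rfl) <;> simp)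
        (hC.trans (by rintro F rfl; simp)))
      (by simp [originalSystem]) (by simp [originalSystem])
  have hTU : ∀ C ⊆ {constraintUV, constraintUU}, constraintUU ∈ C →
      lieSymmetries Ω (truncatedSystem ∪ C) = determinedFields Ω := fun C hC hU =>
    lieSymmetries_eq_determinedFields hΩ
      (Set.union_subset (by rintro F (rfl | rfl) <;> simp)
        (hC.trans (by rintro F (rfl | rfl) <;> simp)))
      (by simp [truncatedSystem]) (by simp [truncatedSystem]) (Or.inr hU)
  have hOU : ∀ C ⊆ {constraintUV, constraintUU}, constraintUU ∈ C →
      lieSymmetries Ω (originalSystem ∪ C) = determinedFields Ω := fun C hC hU =>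
    lieSymmetries_eq_determinedFields hΩ
      (Set.union_subset (by rintro F (rfl | rfl) <;> simp)
        (hC.trans (by rintro F (rfl | rfl) <;> simp)))
      (by simp [originalSystem]) (by simp [originalSystem]) (Or.inr hU)
  have hO0 : lieSymmetries Ω originalSystem = inverseScalingFields Ω := by
    -- The system without constraints is the case `C = ∅`.
    simpa using hO ∅ (Set.empty_subset _)
  refine ⟨?_, fun C hC _ => ?_, ?_, fun hc C hC hU => ?_⟩
  · rw [hO0]
    simpa using hT ∅ (Set.empty_subset _)
  · by_cases hU : constraintUU ∈ C
    · rw [hTU C hC hU, hOU C hC hU]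
    · have hC' : C ⊆ {constraintUV} := fun F hF => by
        rcases hC hF with rfl | rfl
        · rfl
        · exact absurd hF hU
      rw [hT C hC', hO C hC']
  · rw [hT _ subset_rfl, hO0]
  · rw [hTU C hC hU, hO0, determinedFields_eq hΩ hc.isPreconnected]
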